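/- \textbf{Setting.} Let $n\ge 0$, $m\ge1$, $d=2^n$, $N=m\,3^n$. For $\mathbf a\in\{x,y,z\}^n$ and $\mathbf s\in\{-1,1\}^n$ let $P^{\mathbf a}_{\mathbf s}=P^{a_1}_{s_1}\otimes\cdots\otimes P^{a_n}_{s_n}$, where $P^{a}_{s}$ is the orthogonal projection onto the eigenspace of the Pauli matrix $\sigma_a$ for the eigenvalue $s$. Let $\rho^0$ be an $n$-qubit density matrix (a positive semidefinite $d\times d$ complex matrix of trace $1$). For each $\mathbf a$ one observes $R^{\mathbf a}_1,\dots,R^{\mathbf a}_m$, all $N$ variables being independent, with $\mathbb P(R^{\mathbf a}_i=\mathbf s)=\mathrm{Tr}(\rho^0P^{\mathbf a}_{\mathbf s})$. Let $\hat p_{\mathbf a,\mathbf s}=\frac1m\sum_{i=1}^m\mathbf 1_{\{R^{\mathbf a}_i=\mathbf s\}}$, and let $\hat\rho$ be the linear-inversion estimator, i.e. the unique least-squares solution $X$ of the system $\mathrm{Tr}(XP^{\mathbf a}_{\mathbf s})=\hat p_{\mathbf a,\mathbf s}$ (all $\mathbf a,\mathbf s$). Explicitly, with $\sigma_I$ the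 $2\times2$ identity matrix and, for $b\in\{I,x,y,z\}^n$, $\sigma_b=\sigma_{b_1}\otimes\cdots\otimes\sigma_{b_n}$ and $d(b)=\#\{j:b_j=I\}$, $$\hat\rho=\sum_{b}\hat\rho_b\,\sigma_b,\qquad \hat\rho_b=\frac{1}{3^{d(b)}2^n}\sum_{\mathbf a,\mathbf s}\hat p_{\mathbf a,\mathbf s}\prod_{j:\,b_j\neq I}s_j\mathbf 1_{\{a_j=b_j\}} .$$ \textbf{Prior and estimator.} Let $\pi$ be the law of $\sum_{i=1}^d\gamma_iV_iV_i^\dagger$, where $V_1,\dots,V_d$ are i.i.d. uniform on the unit sphere of $\mathbb C^d$ and, independently, $(\gamma_1,\dots,\gamma_d)$ has the Dirichlet distribution with parameters $\alpha_1,\dots,\alpha_d>0$. With $\|\cdot\|_F$ the Frobenius norm, for $\lambda>0$ let $$\tilde\pi_\lambda(d\nu)\propto \exp\left(-\lambda\|\nu-\hat\rho\|_F^2\right)\pi(d\nu),\qquad \tilde\rho_\lambda=\int\nu\,\tilde\pi_\lambda(d\nu).$$ \textbf{Theorem.} For all $D_1,D_2>0$ there is a constant $C>0$, depending only on $D_1$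 and $D_2$, such that for all $n,m$ and $\rho^0$ as above, all parameters satisfying $0<\alpha_i\le1$ for $i=1,\dots,d$, $\sum_{i=1}^d\alpha_i=D_1$ and $\prod_{i=1}^d\alpha_i\ge e^{-D_2\,d\log d}$, and all $\varepsilon\in(0,1)$, the choice $\lambda=\frac{N}{4\cdot5^n}$ gives, with probability at least $1-\varepsilon$, $$\|\tilde\rho_\lambda-\rho^0\|_F^2\le C\,\frac{10^n\,\mathrm{rank}(\rho^0)\log\left(\frac{\mathrm{rank}(\rho^0)N}{2^n}\right)+5^n\log(2/\varepsilon)}{N}.$$ -/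

import Mathlib

open MeasureTheory ProbabilityTheory
open scoped ComplexOrder Matrix.Norms.Frobenius

namespace QuantumTomography

noncomputable section

/-! ### Qubits, Pauli observables and measurement data -/

/-- Index set of the canonical basis of the `n`-qubit space `ℂ^d`, `d = 2 ^ n`. -/
abbrev Idx (n : ℕ) : Type := Fin n → Fin 2

/-- Complex `d × d` matrices, `d = 2 ^ n`. -/
abbrev QMatrix (n : ℕ) : Type := Matrix (Idx n) (Idx n) ℂ

/-- Experiment settings: one of the three Pauli observables `x, y, z` for each qubit. -/
abbrev Setting (n : ℕ) : Type := Fin n → Fin 3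

/-- Outcomes of an experiment: a vector of signs in `{-1, 1}^n`. -/
abbrev Outcome (n : ℕ) : Type := Fin n → ℤˣ

/-- The Pauli matrices `σ_x, σ_y, σ_z`. -/
def pauli : Fin 3 → Matrix (Fin 2) (Fin 2) ℂ :=
  ![!![0, 1; 1, 0], !![0, -Complex.I; Complex.I, 0], !![1, 0; 0, -1]]

/-- The Pauli matrices together with the identity (`none` is the label `I`). -/
def pauliI : Option (Fin 3) → Matrix (Fin 2) (Fin 2) ℂ
  | none => 1
  | some a => pauli a

/-- The orthogonal projection onto the eigenspace of `σ_a` for the eigenvalue `s ∈ {-1, 1}`. -/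
def pauliProj (a : Fin 3) (s : ℤˣ) : Matrix (Fin 2) (Fin 2) ℂ :=
  (1 / 2 : ℂ) • (1 + ((s : ℤ) : ℂ) • pauli a)

/-- `σ_a = P^a_{1} - P^a_{-1}`, with complementary orthogonal projections. -/
theorem pauliProj_spec (a : Fin 3) :
    pauli a = pauliProj a 1 - pauliProj a (-1) ∧ pauliProj a 1 + pauliProj a (-1) = 1 ∧
      ∀ s, (pauliProj a s).IsHermitian ∧ pauliProj a s * pauliProj a s = pauliProj a s := by
  refine ⟨?_, ?_, fun s => ⟨?_, ?_⟩⟩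
  · fin_cases a <;> ext i k <;> fin_cases i <;> fin_cases k <;>
      simp [pauliProj, pauli] <;> ring
  · fin_cases a <;> ext i k <;> fin_cases i <;> fin_cases k <;>
      simp [pauliProj, pauli] <;> ring
  · rcases Int.units_eq_one_or s with rfl | rfl <;>
    fin_cases a <;> ext i k <;> fin_cases i <;> fin_cases k <;>
      simp [pauliProj, pauli] <;> ring
  · rcases Int.units_eq_one_or s with rfl | rfl <;>
    fin_cases a <;> ext i k <;> fin_cases i <;> fin_cases k <;>
      simp [pauliProj, pauli, Matrix.mul_apply, Fin.sum_univ_two] <;> ring_nf <;> simp <;> norm_num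

/-- The tensor (Kronecker) product `A₁ ⊗ ⋯ ⊗ Aₙ` of `2 × 2` matrices. -/
def tensor {n : ℕ} (A : Fin n → Matrix (Fin 2) (Fin 2) ℂ) : QMatrix n :=
  Matrix.of fun i k => ∏ j, A j (i j) (k j)

/-- The element `σ_b = σ_{b₁} ⊗ ⋯ ⊗ σ_{bₙ}` of the `n`-Pauli basis. -/
def pauliBasis {n : ℕ} (b : Fin n → Option (Fin 3)) : QMatrix n :=
  tensor fun j => pauliI (b j)

/-- `P_s^a = P_{s₁}^{a₁} ⊗ ⋯ ⊗ P_{sₙ}^{aₙ}`. -/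
def outcomeProj {n : ℕ} (a : Setting n) (s : Outcome n) : QMatrix n :=
  tensor fun j => pauliProj (a j) (s j)

/-- Density matrices of `n` qubits: positive semidefinite (hence Hermitian) with unit trace. -/
structure IsDensityMatrix {n : ℕ} (ρ : QMatrix n) : Prop where
  posSemidef : ρ.PosSemidef
  trace_eq_one : ρ.trace = 1

/-- The family `R i a` (`i < m`, `a` a setting) is complete measurement data for the state `ρ`:
independent random outcomes, each distributed according to Born's rule. -/
structure IsCompleteData {Ω : Type*} [MeasurableSpace Ω] (μ : Measure Ω) {n m : ℕ}
    (ρ : QMatrix n) (R : Fin m → Setting n → Ω → Outcome n) : Prop where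
  measurable : ∀ i a, Measurable (R i a)
  indep : iIndepFun (fun p : Fin m × Setting n => R p.1 p.2) μ
  born : ∀ i a s, ((μ.real {ω | R i a ω = s} : ℝ) : ℂ) = (ρ * outcomeProj a s).trace

/-- Empirical frequencies of a data set `D`. -/
def empFreq {n m : ℕ} (D : Fin m → Setting n → Outcome n) (a : Setting n) (s : Outcome n) : ℝ :=
  (∑ i, if D i a = s then (1 : ℝ) else 0) / m

/-! ### The linear-inversion (least-squares) estimator -/

/-- `𝐏_{(s,a),b} = ∏_{j : b_j ≠ I} s_j 1(a_j = b_j)`, which is `Trace (σ_b P_s^a)`. -/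
def pauliCoeff {n : ℕ} (a : Setting n) (s : Outcome n) (b : Fin n → Option (Fin 3)) : ℝ :=
  ∏ j, match b j with
    | none => 1
    | some c => if a j = c then ((s j : ℤ) : ℝ) else 0

/-- The linear-inversion estimator `ρ̂ = ∑_b ρ̂_b σ_b` computed from frequencies `q`, where
`ρ̂_b = (3^{#{j : b_j = I}} 2^n)⁻¹ ∑_{a,s} 𝐏_{(s,a),b} q_{a,s}`. It is the unique least-squares
solution `X` of the linear system `Trace (X P_s^a) = q_{a,s}` (`eq_linearInversion_iff`). -/
def linearInversion {n : ℕ} (q : Setting n → Outcome n → ℝ) : QMatrix n :=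
  ∑ b : Fin n → Option (Fin 3),
    (((∑ a, ∑ s, pauliCoeff a s b * q a s) /
      (3 ^ (Finset.univ.filter fun j => b j = none).card * 2 ^ n) : ℝ) : ℂ) • pauliBasis b

theorem trace_tensor_mul {n : ℕ} (A B : Fin n → Matrix (Fin 2) (Fin 2) ℂ) :
    (tensor A * tensor B).trace = ∏ j, (A j * B j).trace := by
  simp only [Matrix.trace, Matrix.diag, Matrix.mul_apply, tensor, Matrix.of_apply]
  rw [Fintype.prod_sum]
  refine Finset.sum_congr rfl fun i _ => ?_
  rw [Fintype.prod_sum]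
  simp only [Finset.prod_mul_distrib]

theorem trace_pauliBasis_mul {n : ℕ} (a : Setting n) (s : Outcome n)
    (b : Fin n → Option (Fin 3)) :
    (pauliBasis b * outcomeProj a s).trace = pauliCoeff a s b := by
  rw [pauliBasis, outcomeProj, trace_tensor_mul, pauliCoeff, Complex.ofReal_prod]
  refine Finset.prod_congr rfl fun j _ => ?_
  generalize a j = x
  generalize b j = y
  rcases y with _ | y <;> rcases Int.units_eq_one_or (s j) with h | h <;> rw [h] <;>
    fin_cases x <;> (try fin_cases y) <;>
      simp [pauliI, pauliProj, pauli, Matrix.trace_fin_two, Matrix.one_fin_two] <;>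
      ring_nf <;> simp

theorem sum_pauliCoeff_mul {n : ℕ} (b b' : Fin n → Option (Fin 3)) :
    ∑ a : Setting n, ∑ s : Outcome n, pauliCoeff a s b * pauliCoeff a s b' =
      if b = b' then 3 ^ (Finset.univ.filter fun j => b j = none).card * 2 ^ n else 0 := by
  let f : Fin 3 → ℤˣ → Option (Fin 3) → ℝ := fun x t y => match y with
        | none => 1
        | some c => if x = c then ((t : ℤ) : ℝ) else 0
  have key : ∀ y y' : Option (Fin 3), ∑ x : Fin 3, ∑ t : ℤˣ, f x t y * f x t y' =
      if y = y' then (if y = none then 3 else 1) * 2 else 0 := by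
    intro y y'
    rcases y with _ | y <;> rcases y' with _ | y' <;> (try fin_cases y) <;> (try fin_cases y') <;>
      simp [f] <;> norm_num
  have h1 : ∑ a : Setting n, ∑ s : Outcome n, pauliCoeff a s b * pauliCoeff a s b' =
      ∏ j, ∑ x : Fin 3, ∑ t : ℤˣ, f x t (b j) * f x t (b' j) := by
    rw [Fintype.prod_sum]
    refine Finset.sum_congr rfl fun a _ => ?_
    rw [Fintype.prod_sum]
    simp only [Finset.prod_mul_distrib]
    rfl
  rw [h1]
  simp only [key]
  split_ifs with h
  · subst h
    have hc := Finset.card_filter_add_card_filter_not (s := Finset.univ) (fun j => b j = none)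
    rw [Finset.card_univ, Fintype.card_fin] at hc
    simp only [if_true, Finset.prod_mul_distrib, Finset.prod_ite, Finset.prod_const, one_pow,
      mul_one, Finset.card_univ, Fintype.card_fin]
  · obtain ⟨j, hj⟩ := Function.ne_iff.mp h
    exact Finset.prod_eq_zero (Finset.mem_univ j) (by simp [hj])

/-- Completeness of the Pauli basis. -/
theorem pauli_expansion {n : ℕ} (M : QMatrix n) :
    M = ∑ b, ((pauliBasis b * M).trace / 2 ^ n) • pauliBasis b := by
  have key : ∀ x y z w : Fin 2, ∑ c : Option (Fin 3), pauliI c x y * pauliI c z w =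
      if x = w ∧ y = z then 2 else 0 := by
    intro x y z w
    fin_cases x <;> fin_cases y <;> fin_cases z <;> fin_cases w <;>
      simp [pauliI, pauli, Fin.sum_univ_three] <;> norm_num
  have h1 : ∀ x y z w : Idx n, ∑ b, pauliBasis b x y * pauliBasis b z w =
      if x = w ∧ y = z then 2 ^ n else 0 := by
    intro x y z w
    simp only [pauliBasis, tensor, Matrix.of_apply, ← Finset.prod_mul_distrib]
    rw [← Fintype.prod_sum (fun j c => pauliI c (x j) (y j) * pauliI c (z j) (w j))]
    simp only [key]
    split_ifs with h
    · simp [h.1, h.2]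
    · rw [not_and_or] at h
      rcases h with h | h <;> obtain ⟨j, hj⟩ := Function.ne_iff.mp h <;>
        exact Finset.prod_eq_zero (Finset.mem_univ j) (by simp [hj])
  ext i k
  simp only [Matrix.trace, Matrix.diag, Matrix.mul_apply, Matrix.sum_apply, Matrix.smul_apply,
    smul_eq_mul, Finset.sum_div, Finset.sum_mul]
  rw [Finset.sum_comm]
  have h2 : ∀ x : Idx n, ∑ b, ∑ y, pauliBasis b x y * M y x / 2 ^ n * pauliBasis b i k =
      if x = k then M i k else 0 := by
    intro x
    rw [Finset.sum_comm]
    have h3 : ∀ y, ∑ b, pauliBasis b x y * M y x / 2 ^ n * pauliBasis b i k =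
        if y = i then (if x = k then M i k else 0) else 0 := by
      intro y
      have h4 := congrArg (fun t => t * (M y x / 2 ^ n)) (h1 x y i k)
      simp only [Finset.sum_mul] at h4
      have h5 : ∀ b : Fin n → Option (Fin 3),
          pauliBasis b x y * M y x / 2 ^ n * pauliBasis b i k =
          pauliBasis b x y * pauliBasis b i k * (M y x / 2 ^ n) := fun b => by ring
      rw [Finset.sum_congr rfl (fun b _ => h5 b), h4]
      by_cases hx : x = k <;> by_cases hy : y = i
      · subst hx; subst hy; simp; field_simp
      all_goals simp [hx, hy]
    rw [Finset.sum_congr rfl (fun y _ => h3 y)]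
    simp
  rw [Finset.sum_congr rfl (fun x _ => h2 x)]
  simp

theorem trace_sum_smul_mul {n : ℕ} (c : (Fin n → Option (Fin 3)) → ℂ) (a : Setting n)
    (s : Outcome n) : ((∑ b, c b • pauliBasis b) * outcomeProj a s).trace =
      ∑ b, c b * pauliCoeff a s b := by
  simp [Finset.sum_mul, Matrix.trace_sum, trace_pauliBasis_mul]

theorem sum_trace_mul_pauliCoeff {n : ℕ} (c : (Fin n → Option (Fin 3)) → ℂ)
    (b : Fin n → Option (Fin 3)) :
    ∑ a, ∑ s, ((∑ b, c b • pauliBasis b) * outcomeProj a s).trace * (pauliCoeff a s b : ℂ) =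
      c b * (3 ^ (Finset.univ.filter fun j => b j = none).card * 2 ^ n) := by
  simp only [trace_sum_smul_mul]
  simp only [Finset.sum_mul]
  rw [Finset.sum_congr rfl fun a _ => Finset.sum_comm, Finset.sum_comm]
  have h : ∀ b' : Fin n → Option (Fin 3), ∑ a : Setting n, ∑ s : Outcome n,
      c b' * (pauliCoeff a s b' : ℂ) * (pauliCoeff a s b : ℂ) = if b' = b then
        c b * (3 ^ (Finset.univ.filter fun j => b j = none).card * 2 ^ n) else 0 := by
    intro b'
    have h1 := congrArg (fun t : ℝ => c b' * (t : ℂ)) (sum_pauliCoeff_mul b' b)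
    simp only [Complex.ofReal_sum, Complex.ofReal_mul, Finset.mul_sum, ← mul_assoc] at h1
    rw [h1]
    by_cases hb : b' = b
    · subst hb; simp
    · simp [hb]
  rw [Finset.sum_congr rfl fun b' _ => h b']
  simp

theorem eq_zero_of_trace_eq_zero {n : ℕ} (M : QMatrix n)
    (h : ∀ a s, (M * outcomeProj a s).trace = 0) : M = 0 := by
  have hM := pauli_expansion M
  have h0 : ∀ b, (pauliBasis b * M).trace / 2 ^ n = 0 := by
    intro b
    have h1 := sum_trace_mul_pauliCoeff (fun b => (pauliBasis b * M).trace / 2 ^ n) b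
    rw [← hM] at h1
    simp only [h, zero_mul, Finset.sum_const_zero] at h1
    exact (mul_eq_zero.mp h1.symm).resolve_right (by positivity)
  rw [hM]
  exact Finset.sum_eq_zero fun b _ => by rw [h0, zero_smul]

theorem linearInversion_normal {n : ℕ} (q : Setting n → Outcome n → ℝ) (M : QMatrix n) :
    ∑ a, ∑ s, ((linearInversion q * outcomeProj a s).trace - (q a s : ℂ)) *
      (M * outcomeProj a s).trace = 0 := by
  have hb : ∀ b, ∑ a, ∑ s, ((linearInversion q * outcomeProj a s).trace - (q a s : ℂ)) *
      (pauliCoeff a s b : ℂ) = 0 := by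
    intro b
    simp only [sub_mul, Finset.sum_sub_distrib]
    rw [linearInversion, sum_trace_mul_pauliCoeff, sub_eq_zero]
    push_cast
    rw [div_mul_cancel₀ _ (by positivity)]
    simp only [mul_comm]
  rw [pauli_expansion M]
  simp only [trace_sum_smul_mul, Finset.mul_sum]
  rw [Finset.sum_congr rfl fun a _ => Finset.sum_comm, Finset.sum_comm]
  refine Finset.sum_eq_zero fun b _ => ?_
  have h1 := congrArg (fun t => ((pauliBasis b * M).trace / 2 ^ n) * t) (hb b)
  simp only [Finset.mul_sum, mul_zero] at h1
  rw [← h1]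
  exact Finset.sum_congr rfl fun a _ => Finset.sum_congr rfl fun s _ => by ring

/-- The sum of squared residuals of the linear system `Trace (X P_s^a) = q_{a,s}`. -/
def residual {n : ℕ} (q : Setting n → Outcome n → ℝ) (X : QMatrix n) : ℝ :=
  ∑ a, ∑ s, ‖(X * outcomeProj a s).trace - (q a s : ℂ)‖ ^ 2

theorem residual_eq {n : ℕ} (q : Setting n → Outcome n → ℝ) (X : QMatrix n) :
    residual q X = residual q (linearInversion q) +
      ∑ a, ∑ s, ‖((X - linearInversion q) * outcomeProj a s).trace‖ ^ 2 := by
  have h := congrArg (fun t : ℂ => 2 * t.re) (linearInversion_normal q (X - linearInversion q))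
  simp only [Complex.re_sum, Finset.mul_sum, Complex.zero_re, mul_zero] at h
  simp only [residual]
  rw [← add_zero (_ + _), ← h]
  simp only [← Finset.sum_add_distrib]
  refine Finset.sum_congr rfl fun a _ => Finset.sum_congr rfl fun s _ => ?_
  have him : ((linearInversion q * outcomeProj a s).trace - (q a s : ℂ)).im = 0 := by
    rw [linearInversion, trace_sum_smul_mul]
    simp only [← Complex.ofReal_mul, ← Complex.ofReal_sum, ← Complex.ofReal_sub,
      Complex.ofReal_im]
  have hX : (X * outcomeProj a s).trace - (q a s : ℂ) =
      ((linearInversion q * outcomeProj a s).trace - (q a s : ℂ)) +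
        ((X - linearInversion q) * outcomeProj a s).trace := by
    rw [sub_mul, Matrix.trace_sub]; ring
  rw [hX]
  simp only [← Complex.normSq_eq_norm_sq, Complex.normSq_apply, Complex.add_re, Complex.add_im,
    Complex.mul_re, him]
  ring

/-- The linear-inversion estimator is the unique least-squares solution of the linear system
`Trace (X P_s^a) = q_{a,s}`. -/
theorem eq_linearInversion_iff {n : ℕ} (q : Setting n → Outcome n → ℝ) (X : QMatrix n) :
    X = linearInversion q ↔ ∀ Y, residual q X ≤ residual q Y := by
  constructor
  · rintro rfl Y
    rw [residual_eq q Y]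
    exact le_add_of_nonneg_right (by positivity)
  · intro h
    have h1 := h (linearInversion q)
    rw [residual_eq q X] at h1
    have h2 : ∑ a, ∑ s, ‖((X - linearInversion q) * outcomeProj a s).trace‖ ^ 2 = 0 :=
      le_antisymm (by linarith) (by positivity)
    rw [← sub_eq_zero]
    refine eq_zero_of_trace_eq_zero _ fun a s => ?_
    rw [Finset.sum_eq_zero_iff_of_nonneg fun _ _ => by positivity] at h2
    have h3 := h2 a (Finset.mem_univ a)
    rw [Finset.sum_eq_zero_iff_of_nonneg fun _ _ => by positivity] at h3
    simpa using h3 s (Finset.mem_univ s)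

/-! ### The prior -/

/-- The Dirichlet distribution with parameters `α_i > 0`: the law of `(G_i / ∑_k G_k)_i` for
independent `G_i ∼ Gamma(α_i, 1)`. -/
def dirichlet {ι : Type*} [Fintype ι] (α : ι → ℝ) : Measure (ι → ℝ) :=
  (Measure.pi fun i => gammaMeasure (α i) 1).map fun g i => g i / ∑ k, g k

/-- The unit sphere of `ℂ^d`, `d = 2 ^ n`. -/
abbrev USphere (n : ℕ) : Type := Metric.sphere (0 : EuclideanSpace ℂ (Idx n)) 1

/-- The uniform distribution on the unit sphere of `ℂ^d`: normalized surface measure. -/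
def uniformSphere (n : ℕ) : Measure (USphere n) :=
  ((volume : Measure (EuclideanSpace ℂ (Idx n))).toSphere Set.univ)⁻¹ •
    (volume : Measure (EuclideanSpace ℂ (Idx n))).toSphere

/-- `∑_i γ_i V_i V_i†`. -/
def mixture {n : ℕ} (γ : Fin (2 ^ n) → ℝ) (V : Fin (2 ^ n) → USphere n) : QMatrix n :=
  ∑ i, (γ i : ℂ) • Matrix.vecMulVec (V i : EuclideanSpace ℂ (Idx n)).ofLp
    (star (V i : EuclideanSpace ℂ (Idx n)).ofLp)

/-- Entrywise measurable structure on matrices (the Borel one). -/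
instance instMeasurableSpaceQMatrix (n : ℕ) : MeasurableSpace (QMatrix n) :=
  inferInstanceAs (MeasurableSpace (Idx n → Idx n → ℂ))

/-- The prior `π(dρ)`: the law of `∑_i γ_i V_i V_i†`, where `γ ∼ Dir(α)` and the `V_i` are
i.i.d. uniform on the unit sphere, independent of `γ`. -/
def prior (n : ℕ) (α : Fin (2 ^ n) → ℝ) : Measure (QMatrix n) :=
  ((dirichlet α).prod (Measure.pi fun _ : Fin (2 ^ n) => uniformSphere n)).map
    fun p => mixture p.1 p.2

/-- Conditions on the Dirichlet parameters, with constants `D₁, D₂` and `d = 2 ^ n`. -/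
structure PriorAssumption (D₁ D₂ : ℝ) (n : ℕ) (α : Fin (2 ^ n) → ℝ) : Prop where
  pos : ∀ i, 0 < α i
  le_one : ∀ i, α i ≤ 1
  sum_eq : ∑ i, α i = D₁
  prod_ge : Real.exp (-D₂ * (2 : ℝ) ^ n * Real.log ((2 : ℝ) ^ n)) ≤ ∏ i, α i

/-! ### The dens-estimator -/

/-- `ℓ^dens(ν, D) = ‖ν - ρ̂‖_F²`. -/
def lossDens {n m : ℕ} (ν : QMatrix n) (D : Fin m → Setting n → Outcome n) : ℝ :=
  ‖ν - linearInversion (empFreq D)‖ ^ 2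

/-- The pseudo-posterior, proportional to `exp (-lam * ℓ^dens(ν, D)) π(dν)`. -/
def posteriorDens {n m : ℕ} (α : Fin (2 ^ n) → ℝ) (lam : ℝ)
    (D : Fin m → Setting n → Outcome n) : Measure (QMatrix n) :=
  (prior n α).tilted fun ν => -lam * lossDens ν D

/-- The dens-estimator: the mean `∫ ν π̃(dν)` (taken entrywise) of the pseudo-posterior. -/
def densEstimator {n m : ℕ} (α : Fin (2 ^ n) → ℝ) (lam : ℝ)
    (D : Fin m → Setting n → Outcome n) : QMatrix n :=
  Matrix.of fun i k => ∫ ν, ν i k ∂(posteriorDens α lam D)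

end

end QuantumTomography

namespace QuantumTomography

/-! ### Frobenius geometry in the Pauli basis -/

/-! The proof is a PAC-Bayesian argument in exponential form, fed by a Hoeffding bound and a lower
bound on the prior mass of small balls.

Noise. For fixed `A`, the inner product of `A` with ρ̂ - ρ⁰ is a sum of independent centred bounded
terms, hence sub-Gaussian; its variance proxy is at most (2^n / N) ‖A‖²
(`lintegral_exp_frobRe_error_le`). The size of ρ̂ - ρ⁰ itself never enters: in a difference of two
losses its square cancels and only a linear term survives.

PAC-Bayes. Jensen's inequality for exp(λ/4 ‖x - ρ⁰‖²) moves the posterior mean inside the posterior.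
The random normalizing constant is bounded below by Cauchy–Schwarz on a ball `B` around ρ⁰. The
product of the two bounds is a double integral against the fixed measure π × π|_B, so Tonelli, the
moment bound and Markov's inequality apply (`measureReal_tilted_mean_le`). The price is log(1/π(B))
/ λ.

Prior mass. A ball around ρ⁰ contains the mixtures whose weights are close to the eigenvalues in ℓ¹
and whose vectors are close to the eigenvectors. Vectors of zero eigenvalues are left free, so only
rank(ρ⁰) spherical caps are paid for, each costing an exponent 2d (`le_prior_closedBall`). With
radius 1/N this gives log(1/π(B)) of order d · rank · (log d + log N + 1). -/

theorem sq_norm_eq_sum {n : ℕ} (A : QMatrix n) : ‖A‖ ^ 2 = ∑ i, ∑ j, ‖A i j‖ ^ 2 := by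
  rw [Matrix.frobenius_norm_def, ← Real.sqrt_eq_rpow, Real.sq_sqrt (by positivity)]
  simp

theorem sq_norm_eq_trace {n : ℕ} (A : QMatrix n) : ‖A‖ ^ 2 = (A.conjTranspose * A).trace.re := by
  rw [sq_norm_eq_sum, Finset.sum_comm]
  simp only [Matrix.trace, Matrix.diag, Matrix.mul_apply, Matrix.conjTranspose_apply,
    Complex.re_sum]
  refine Finset.sum_congr rfl fun i _ => Finset.sum_congr rfl fun j _ => ?_
  rw [← Complex.normSq_eq_norm_sq, Complex.normSq_apply]
  simp

/-- The real part of the Frobenius inner product. -/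
noncomputable def frobRe {n : ℕ} (A B : QMatrix n) : ℝ := (A.conjTranspose * B).trace.re

theorem frobRe_comm {n : ℕ} (A B : QMatrix n) : frobRe A B = frobRe B A := by
  have h : (B.conjTranspose * A).trace = star (A.conjTranspose * B).trace := by
    rw [← Matrix.trace_conjTranspose, Matrix.conjTranspose_mul, Matrix.conjTranspose_conjTranspose]
  rw [frobRe, frobRe, h]
  simp

theorem frobRe_sub_left {n : ℕ} (A B C : QMatrix n) :
    frobRe (A - B) C = frobRe A C - frobRe B C := by
  simp [frobRe, Matrix.conjTranspose_sub, sub_mul]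

theorem sq_norm_sub {n : ℕ} (A B : QMatrix n) :
    ‖A - B‖ ^ 2 = ‖A‖ ^ 2 - 2 * frobRe A B + ‖B‖ ^ 2 := by
  have h := frobRe_comm A B
  simp only [frobRe] at h
  simp only [sq_norm_eq_trace, frobRe, Matrix.conjTranspose_sub, sub_mul, mul_sub,
    Matrix.trace_sub, Complex.sub_re]
  linarith

theorem pauliBasis_isHermitian {n : ℕ} (b : Fin n → Option (Fin 3)) :
    (pauliBasis b).IsHermitian := by
  have key : ∀ y : Option (Fin 3), (pauliI y).IsHermitian := by
    intro y
    rcases y with _ | y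
    · exact Matrix.isHermitian_one
    · fin_cases y <;> ext i k <;> fin_cases i <;> fin_cases k <;> simp [pauliI, pauli]
  ext i k
  simp only [pauliBasis, tensor, Matrix.conjTranspose_apply, Matrix.of_apply, star_prod]
  exact Finset.prod_congr rfl fun j _ => (key (b j)).apply _ _

theorem trace_conjTranspose_mul_pauliBasis {n : ℕ} (A : QMatrix n) (b : Fin n → Option (Fin 3)) :
    (A.conjTranspose * pauliBasis b).trace = star (pauliBasis b * A).trace := by
  rw [← Matrix.trace_conjTranspose, Matrix.conjTranspose_mul, (pauliBasis_isHermitian b).eq]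

/-- Parseval's identity in the Pauli basis. -/
theorem sum_sq_trace_pauliBasis {n : ℕ} (A : QMatrix n) :
    ∑ b, ‖(pauliBasis b * A).trace‖ ^ 2 / 2 ^ n = ‖A‖ ^ 2 := by
  rw [sq_norm_eq_trace]
  conv_rhs => rw [pauli_expansion A, ← pauli_expansion A]
  conv_rhs => rhs; rhs; rhs; rw [pauli_expansion A]
  simp only [Finset.mul_sum, Matrix.trace_sum, Matrix.mul_smul, Matrix.trace_smul, smul_eq_mul,
    trace_conjTranspose_mul_pauliBasis, Complex.re_sum]
  refine Finset.sum_congr rfl fun b _ => ?_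
  rw [div_mul_eq_mul_div, Complex.star_def, Complex.mul_conj, Complex.normSq_eq_norm_sq]
  norm_cast

/-- `∑_b A_b 3^{-d(b)} 𝐏_{(s,a),b}`: the coefficient of `q_{a,s}` in the inner product of `A`
with the linear-inversion estimator. -/
noncomputable def linearWeight {n : ℕ} (A : QMatrix n) (a : Setting n) (s : Outcome n) : ℝ :=
  ∑ b : Fin n → Option (Fin 3), (pauliBasis b * A).trace.re /
    (3 ^ (Finset.univ.filter fun j => b j = none).card * 2 ^ n) * pauliCoeff a s b

theorem frobRe_linearInversion {n : ℕ} (A : QMatrix n) (q : Setting n → Outcome n → ℝ) :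
    frobRe A (linearInversion q) = ∑ a, ∑ s, q a s * linearWeight A a s := by
  simp only [frobRe, linearInversion, Finset.mul_sum, Matrix.trace_sum, Matrix.mul_smul,
    Matrix.trace_smul, smul_eq_mul, trace_conjTranspose_mul_pauliBasis, Complex.re_sum,
    Complex.re_ofReal_mul, Complex.star_def, Complex.conj_re, linearWeight]
  simp only [div_mul_eq_mul_div, Finset.sum_div, Finset.sum_mul]
  rw [Finset.sum_comm]
  refine Finset.sum_congr rfl fun a _ => ?_
  rw [Finset.sum_comm]
  refine Finset.sum_congr rfl fun s _ => Finset.sum_congr rfl fun b _ => ?_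
  ring

theorem pauliCoeff_sq {n : ℕ} (a : Setting n) (s : Outcome n) (b : Fin n → Option (Fin 3)) :
    pauliCoeff a s b ^ 2 = pauliCoeff a 1 b := by
  rw [pauliCoeff, pauliCoeff, ← Finset.prod_pow]
  refine Finset.prod_congr rfl fun j _ => ?_
  rcases b j with _ | c
  · simp
  · rcases Int.units_eq_one_or (s j) with h | h <;> by_cases hc : a j = c <;> simp [h, hc]

theorem pauliCoeff_one_nonneg {n : ℕ} (a : Setting n) (b : Fin n → Option (Fin 3)) :
    0 ≤ pauliCoeff a 1 b := by
  rw [← pauliCoeff_sq a 1]; positivity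

theorem three_pow_card {n : ℕ} (b : Fin n → Option (Fin 3)) :
    (3 : ℝ) ^ (Finset.univ.filter fun j => b j = none).card =
      ∏ j, if b j = none then (3 : ℝ) else 1 := by
  simp [Finset.prod_ite]

theorem sum_settings_pauliCoeff_one {n : ℕ} (b : Fin n → Option (Fin 3)) :
    ∑ a : Setting n, pauliCoeff a 1 b = 3 ^ (Finset.univ.filter fun j => b j = none).card := by
  rw [three_pow_card]
  simp only [pauliCoeff]
  refine (Fintype.prod_sum (fun j (x : Fin 3) => (match b j with
    | none => (1 : ℝ)
    | some c => if x = c then (((1 : Outcome n) j : ℤ) : ℝ) else 0))).symm.trans ?_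
  refine Finset.prod_congr rfl fun j _ => ?_
  rcases b j with _ | c <;> simp

theorem sum_pauliCoeff_one_div {n : ℕ} (a : Setting n) :
    ∑ b : Fin n → Option (Fin 3),
      pauliCoeff a 1 b / 3 ^ (Finset.univ.filter fun j => b j = none).card = (4 / 3) ^ n := by
  simp only [three_pow_card, pauliCoeff, ← Finset.prod_div_distrib]
  refine (Fintype.prod_sum (fun j (y : Option (Fin 3)) => (match y with
    | none => (1 : ℝ)
    | some c => if a j = c then (((1 : Outcome n) j : ℤ) : ℝ) else 0) /
      if y = none then (3 : ℝ) else 1)).symm.trans ?_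
  simp [Fintype.sum_option]
  norm_num

/-- A bound on `linearWeight A a s ^ 2` which is uniform in the outcome `s`. -/
noncomputable def weightBound {n : ℕ} (A : QMatrix n) (a : Setting n) : ℝ :=
  (4 / 3) ^ n * ∑ b : Fin n → Option (Fin 3), ((pauliBasis b * A).trace.re / 2 ^ n) ^ 2 *
    (pauliCoeff a 1 b / 3 ^ (Finset.univ.filter fun j => b j = none).card)

theorem linearWeight_sq_le {n : ℕ} (A : QMatrix n) (a : Setting n) (s : Outcome n) :
    linearWeight A a s ^ 2 ≤ weightBound A a := by
  rw [weightBound, mul_comm, ← sum_pauliCoeff_one_div a, linearWeight]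
  refine Finset.sum_sq_le_sum_mul_sum_of_sq_le_mul _ (fun b _ => ?_) (fun b _ => ?_) fun b _ => ?_
  · have := pauliCoeff_one_nonneg a b; positivity
  · have := pauliCoeff_one_nonneg a b; positivity
  · have h1 := pauliCoeff_sq a s b
    have h2 := pauliCoeff_sq a 1 b
    refine le_of_eq ?_
    rw [mul_pow, h1]
    conv_lhs => rw [← h2]
    field_simp

theorem weightBound_nonneg {n : ℕ} (A : QMatrix n) (a : Setting n) : 0 ≤ weightBound A a :=
  (sq_nonneg _).trans (linearWeight_sq_le A a 1)

/-- The rate per qubit is 4/3 from Cauchy–Schwarz times 1/2 from Parseval. Bounding each setting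
separately and then summing is what makes Hoeffding's inequality sharp enough. -/
theorem sum_weightBound_le {n : ℕ} (A : QMatrix n) :
    ∑ a, weightBound A a ≤ (2 / 3) ^ n * ‖A‖ ^ 2 := by
  simp only [weightBound, ← Finset.mul_sum]
  rw [Finset.sum_comm]
  simp only [← Finset.mul_sum, ← Finset.sum_div, sum_settings_pauliCoeff_one]
  have h3 : (2 / 3 : ℝ) ^ n = (4 / 3) ^ n * (1 / 2) ^ n := by rw [← mul_pow]; norm_num
  rw [h3, mul_assoc, ← sum_sq_trace_pauliBasis A]
  simp only [Finset.mul_sum]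
  refine Finset.sum_le_sum fun b _ => mul_le_mul_of_nonneg_left ?_ (by positivity)
  rw [div_self (by positivity), mul_one, div_pow, one_div, inv_pow]
  have h := Complex.abs_re_le_norm (pauliBasis b * A).trace
  have h2 : (pauliBasis b * A).trace.re ^ 2 ≤ ‖(pauliBasis b * A).trace‖ ^ 2 := by
    rw [← sq_abs]; gcongr
  calc _ ≤ ‖(pauliBasis b * A).trace‖ ^ 2 / (2 ^ n) ^ 2 := by gcongr
    _ = _ := by field_simp

/-! ### Sub-Gaussian fluctuations of the linear-inversion estimator -/

instance instDiscreteMeasurableSpaceIntUnits : DiscreteMeasurableSpace ℤˣ :=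
  ⟨fun s => ⟨Set.image Units.val s, .of_discrete, Set.preimage_image_eq s Units.val_injective⟩⟩

instance instDiscreteMeasurableSpaceOutcome (n : ℕ) : DiscreteMeasurableSpace (Outcome n) :=
  inferInstanceAs (DiscreteMeasurableSpace (Fin n → ℤˣ))

theorem linearInversion_sub {n : ℕ} (q q' : Setting n → Outcome n → ℝ) :
    linearInversion q - linearInversion q' = linearInversion fun a s => q a s - q' a s := by
  simp only [linearInversion, ← Finset.sum_sub_distrib, ← sub_smul, ← Complex.ofReal_sub,
    ← sub_div, mul_sub]

/-- A consistent system has zero residual at `M`, and the least-squares solution is unique. With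
Born probabilities this is the unbiasedness of the estimator. -/
theorem linearInversion_trace {n : ℕ} (M : QMatrix n) (p : Setting n → Outcome n → ℝ)
    (h : ∀ a s, (p a s : ℂ) = (M * outcomeProj a s).trace) : linearInversion p = M := by
  refine ((eq_linearInversion_iff p M).2 fun Y => ?_).symm
  have h0 : residual p M = 0 := by simp [residual, h]
  rw [h0]
  unfold residual
  positivity

section Concentration

variable {Ω : Type*} [MeasurableSpace Ω] {μ : Measure Ω} [IsProbabilityMeasure μ] {n m : ℕ}
  {ρ : QMatrix n} {R : Fin m → Setting n → Ω → Outcome n}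

theorem frobRe_error_eq (hm : 0 < m) (hR : IsCompleteData μ ρ R) (A : QMatrix n) (ω : Ω) :
    frobRe A (linearInversion (empFreq fun i a => R i a ω) - ρ) =
      ∑ p : Fin m × Setting n, (linearWeight A p.2 (R p.1 p.2 ω) / m -
        ∫ ω', linearWeight A p.2 (R p.1 p.2 ω') / m ∂μ) := by
  have hint : ∀ i a, ∫ ω', linearWeight A a (R i a ω') / m ∂μ =
      ∑ s, (μ.real {ω | R i a ω = s}) * (linearWeight A a s / m) := by
    intro i a
    have h1 := integral_map (μ := μ) (hR.measurable i a).aemeasurable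
      (f := fun s => linearWeight A a s / m) (by fun_prop)
    have := Measure.isProbabilityMeasure_map (μ := μ) (hR.measurable i a).aemeasurable
    rw [← h1, integral_fintype .of_finite]
    refine Finset.sum_congr rfl fun s _ => ?_
    rw [smul_eq_mul, map_measureReal_apply (hR.measurable i a) .of_discrete]
    rfl
  -- Replacing `ρ` by the inversion of its own outcome probabilities makes the error linear in the
  -- centred frequencies; index `0` serves for all repetitions, which are identically distributed.
  have hp : linearInversion (fun a s => μ.real {ω | R ⟨0, hm⟩ a ω = s}) = ρ :=
    linearInversion_trace _ _ fun a s => hR.born _ _ _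
  have heq : ∀ i a s, μ.real {ω | R i a ω = s} = μ.real {ω | R ⟨0, hm⟩ a ω = s} := fun i a s => by
    exact_mod_cast (hR.born i a s).trans (hR.born _ a s).symm
  have hm' : (m : ℝ) ≠ 0 := by positivity
  simp only [hint, heq]
  conv_lhs => rw [← hp]
  rw [linearInversion_sub, frobRe_linearInversion, Fintype.sum_prod_type_right]
  refine Finset.sum_congr rfl fun a _ => ?_
  simp only [sub_mul, Finset.sum_sub_distrib, empFreq, Finset.sum_div, Finset.sum_mul]
  congr 1
  · rw [Finset.sum_comm]
    refine Finset.sum_congr rfl fun i _ => ?_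
    rw [Finset.sum_eq_single (R i a ω)] <;> simp +contextual [div_eq_inv_mul, eq_comm]
  · rw [Finset.sum_const, Finset.card_univ, Fintype.card_fin, nsmul_eq_mul, Finset.mul_sum]
    exact Finset.sum_congr rfl fun s _ => by field_simp

theorem lintegral_exp_frobRe_error_le (hm : 0 < m) (hR : IsCompleteData μ ρ R) (A : QMatrix n)
    (t : ℝ) :
    ∫⁻ ω, ENNReal.ofReal (Real.exp (t * frobRe A
      (linearInversion (empFreq fun i a => R i a ω) - ρ))) ∂μ ≤
      ENNReal.ofReal (Real.exp (t ^ 2 / 2 * (2 ^ n / (m * 3 ^ n)) * ‖A‖ ^ 2)) := by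
  -- Hoeffding's parameter, the square of half the length of the interval; it equals `weightBound A
  -- p.2 / m ^ 2`.
  let c : Fin m × Setting n → NNReal := fun p =>
    (‖√(weightBound A p.2) / m - (-(√(weightBound A p.2) / m))‖₊ / 2) ^ 2
  have hind : iIndepFun (fun (p : Fin m × Setting n) ω => linearWeight A p.2 (R p.1 p.2 ω) / m -
      ∫ ω', linearWeight A p.2 (R p.1 p.2 ω') / m ∂μ) μ :=
    hR.indep.comp (fun (p : Fin m × Setting n) s => linearWeight A p.2 s / m -
      ∫ ω', linearWeight A p.2 (R p.1 p.2 ω') / m ∂μ) fun _ => .of_discrete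
  have hsub := HasSubgaussianMGF.sum_of_iIndepFun hind (c := c) (s := Finset.univ) (by
    intro p _
    refine hasSubgaussianMGF_of_mem_Icc (X := fun ω => linearWeight A p.2 (R p.1 p.2 ω) / m)
      (Measurable.aemeasurable (by
        have := hR.measurable p.1 p.2
        have h2 : Measurable (fun s => linearWeight A p.2 s / m) := .of_discrete
        exact h2.comp this)) (ae_of_all _ fun ω => ?_)
    have h := Real.abs_le_sqrt (linearWeight_sq_le A p.2 (R p.1 p.2 ω))
    rw [abs_le] at h
    constructor
    · rw [← neg_div]; gcongr; exact h.1
    · gcongr; exact h.2)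
  simp only [← frobRe_error_eq hm hR A] at hsub
  rw [← ofReal_integral_eq_lintegral_ofReal (hsub.integrable_exp_mul t)
    (ae_of_all _ fun _ => (Real.exp_pos _).le)]
  refine ENNReal.ofReal_le_ofReal ((hsub.mgf_le t).trans (Real.exp_le_exp.2 ?_))
  have hm' : (0 : ℝ) < m := by positivity
  have hc : ∀ p, (c p : ℝ) = weightBound A p.2 / m ^ 2 := by
    intro p
    have h0 := weightBound_nonneg A p.2
    simp only [c, NNReal.coe_pow, NNReal.coe_div, coe_nnnorm, NNReal.coe_ofNat]
    rw [sub_neg_eq_add, Real.norm_of_nonneg (by positivity), add_self_div_two, div_pow,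
      Real.sq_sqrt h0]
  have hsum : ((∑ p, c p : NNReal) : ℝ) ≤ 2 ^ n / (m * 3 ^ n) * ‖A‖ ^ 2 := by
    rw [NNReal.coe_sum]
    simp only [hc]
    rw [Fintype.sum_prod_type]
    simp only [← Finset.sum_div, Finset.sum_const, Finset.card_univ, Fintype.card_fin, nsmul_eq_mul]
    calc (m : ℝ) * (∑ a, weightBound A a) / m ^ 2
        ≤ m * ((2 / 3) ^ n * ‖A‖ ^ 2) / m ^ 2 := by gcongr; exact sum_weightBound_le A
      _ = _ := by rw [div_pow]; field_simp
  calc _ ≤ (2 ^ n / (m * 3 ^ n) * ‖A‖ ^ 2) * t ^ 2 / 2 := by gcongr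
    _ = _ := by ring

end Concentration

/-! ### A PAC-Bayesian bound for Gaussian pseudo-posteriors -/

section Jensen

/-- Jensen's inequality is applied to the exponential itself rather than to the squared norm, so no
variational formula with a Kullback–Leibler term is needed later. -/
theorem convexOn_exp_sq_norm_sub {E : Type*} [NormedAddCommGroup E] [NormedSpace ℝ E] (x₀ : E)
    {c : ℝ} (hc : 0 ≤ c) :
    ConvexOn ℝ Set.univ fun x : E => Real.exp (c * ‖x - x₀‖ ^ 2) := by
  have h1 : ConvexOn ℝ Set.univ fun x : E => ‖x - x₀‖ := by
    simpa [dist_eq_norm] using convexOn_univ_dist x₀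
  have h2 : ConvexOn ℝ Set.univ fun x : E => c * ‖x - x₀‖ ^ 2 :=
    (h1.pow (fun _ _ => norm_nonneg _) 2).smul hc
  refine ⟨convex_univ, fun x hx y hy a b ha hb hab => ?_⟩
  exact (Real.exp_le_exp.2 (h2.2 hx hy ha hb hab)).trans
    (convexOn_exp.2 (Set.mem_univ _) (Set.mem_univ _) ha hb hab)

variable {E : Type*} [NormedAddCommGroup E] [MeasurableSpace E] [BorelSpace E]
  (π : Measure E) [IsProbabilityMeasure π] {lam : ℝ} (x₀ y : E)

theorem integrable_exp_neg_sq_norm (hlam : 0 < lam) :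
    Integrable (fun x => Real.exp (-lam * ‖x - y‖ ^ 2)) π := by
  refine Integrable.of_bound (C := 1) (Measurable.aestronglyMeasurable (by fun_prop))
    (ae_of_all _ fun x => ?_)
  rw [Real.norm_of_nonneg (Real.exp_pos _).le, Real.exp_le_one_iff]
  have : 0 ≤ lam * ‖x - y‖ ^ 2 := by positivity
  linarith

/-- The measure need not have bounded support, but (‖x - y‖ + ‖y - x₀‖)² ≤ 2‖x - y‖² + 2‖y - x₀‖²,
so a growth rate of `lam / 4` is absorbed by the Gaussian factor. -/
theorem integrable_exp_sq_norm_mul (hlam : 0 < lam) :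
    Integrable (fun x => Real.exp (lam / 4 * ‖x - x₀‖ ^ 2 + -lam * ‖x - y‖ ^ 2)) π := by
  refine Integrable.of_bound (C := Real.exp (lam / 2 * ‖y - x₀‖ ^ 2))
    (Measurable.aestronglyMeasurable (by fun_prop)) (ae_of_all _ fun x => ?_)
  rw [Real.norm_of_nonneg (Real.exp_pos _).le, Real.exp_le_exp]
  have h1 : ‖x - x₀‖ ≤ ‖x - y‖ + ‖y - x₀‖ := norm_sub_le_norm_sub_add_norm_sub x y x₀
  have h2 : ‖x - x₀‖ ^ 2 ≤ 2 * ‖x - y‖ ^ 2 + 2 * ‖y - x₀‖ ^ 2 := by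
    nlinarith [norm_nonneg (x - x₀), sq_nonneg (‖x - y‖ - ‖y - x₀‖)]
  nlinarith [sq_nonneg ‖x - y‖]

theorem integrable_exp_sq_norm_tilted (hlam : 0 < lam) :
    Integrable (fun x => Real.exp (lam / 4 * ‖x - x₀‖ ^ 2))
      (π.tilted fun x => -lam * ‖x - y‖ ^ 2) := by
  rw [integrable_tilted_iff (integrable_exp_neg_sq_norm π y hlam)]
  refine (integrable_exp_sq_norm_mul π x₀ y hlam).congr (ae_of_all _ fun x => ?_)
  simp only [smul_eq_mul]
  rw [← Real.exp_add, add_comm]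

theorem integrableOn_exp_sq_norm_closedBall (hlam : 0 < lam) (r : ℝ) :
    IntegrableOn (fun x => Real.exp (lam * ‖x - y‖ ^ 2)) (Metric.closedBall x₀ r) π := by
  refine IntegrableOn.of_bound (measure_lt_top _ _) (C := Real.exp (lam * (r + ‖x₀ - y‖) ^ 2))
    (Measurable.aestronglyMeasurable (by fun_prop)) ?_
  filter_upwards [ae_restrict_mem Metric.isClosed_closedBall.measurableSet] with x hx
  rw [Real.norm_of_nonneg (Real.exp_pos _).le, Real.exp_le_exp]
  have h1 : ‖x - y‖ ≤ r + ‖x₀ - y‖ :=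
    (norm_sub_le_norm_sub_add_norm_sub x x₀ y).trans (by gcongr; exact mem_closedBall_iff_norm.1 hx)
  gcongr

/-- The normalizing constant of a Gaussian pseudo-posterior is bounded from below through the
Cauchy–Schwarz inequality on a ball. -/
theorem sq_measureReal_closedBall_le (hlam : 0 < lam) (r : ℝ) :
    π.real (Metric.closedBall x₀ r) ^ 2 ≤ (∫ x, Real.exp (-lam * ‖x - y‖ ^ 2) ∂π) *
      ∫ x in Metric.closedBall x₀ r, Real.exp (lam * ‖x - y‖ ^ 2) ∂π := by
  set B := Metric.closedBall x₀ r
  set W := ∫ x in B, Real.exp (lam * ‖x - y‖ ^ 2) ∂π with hW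
  have hW1 : π.real B ≤ W := by
    have h := setIntegral_mono (integrableOn_const (C := (1 : ℝ)) (s := B) (μ := π)
      (measure_ne_top _ _)) (integrableOn_exp_sq_norm_closedBall π x₀ y hlam r)
      (fun x => Real.one_le_exp (by positivity))
    simpa using h
  rcases (measureReal_nonneg (μ := π) (s := B)).eq_or_lt with h0 | h0
  · rw [← h0]
    have h1 : 0 ≤ ∫ x, Real.exp (-lam * ‖x - y‖ ^ 2) ∂π :=
      integral_nonneg fun _ => (Real.exp_pos _).le
    have h2 : 0 ≤ W := by linarith
    rw [zero_pow two_ne_zero]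
    exact mul_nonneg h1 h2
  have hWpos : 0 < W := h0.trans_le hW1
  -- Integrating v (1 - c / v)² ≥ 0 over `B`, where v is the Gaussian weight, proves Cauchy–Schwarz
  -- by completing the square; this `c` optimizes the resulting lower bound 2cπ(B) - c²W.
  set c := π.real B / W with hc
  have hZ1 : ∫ x in B, Real.exp (-lam * ‖x - y‖ ^ 2) ∂π ≤
      ∫ x, Real.exp (-lam * ‖x - y‖ ^ 2) ∂π :=
    setIntegral_le_integral (integrable_exp_neg_sq_norm π y hlam)
      (ae_of_all _ fun _ => (Real.exp_pos _).le)
  have hZ2 : ∫ x in B, (2 * c - c ^ 2 * Real.exp (lam * ‖x - y‖ ^ 2)) ∂π ≤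
      ∫ x in B, Real.exp (-lam * ‖x - y‖ ^ 2) ∂π := by
    refine setIntegral_mono ((integrableOn_const (measure_ne_top _ _)).sub
      ((integrableOn_exp_sq_norm_closedBall π x₀ y hlam r).const_mul _))
      (integrable_exp_neg_sq_norm π y hlam).integrableOn fun x => ?_
    have h1 : Real.exp (lam * ‖x - y‖ ^ 2) * Real.exp (-lam * ‖x - y‖ ^ 2) = 1 := by
      rw [← Real.exp_add]; simp
    set u := Real.exp (lam * ‖x - y‖ ^ 2)
    set v := Real.exp (-lam * ‖x - y‖ ^ 2)
    have hv : 0 < v := Real.exp_pos _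
    have hu : 0 < u := Real.exp_pos _
    have h2 : v * (1 - c * u) ^ 2 = v - 2 * c + c ^ 2 * u := by
      linear_combination (-2 * c + c ^ 2 * u) * h1
    have h3 : 0 ≤ v * (1 - c * u) ^ 2 := by positivity
    linarith
  have hZ3 : ∫ x in B, (2 * c - c ^ 2 * Real.exp (lam * ‖x - y‖ ^ 2)) ∂π =
      2 * c * π.real B - c ^ 2 * W := by
    rw [integral_sub (integrable_const _)
      ((integrableOn_exp_sq_norm_closedBall π x₀ y hlam r).const_mul _), integral_const_mul (c ^ 2),
      setIntegral_const, smul_eq_mul, ← hW]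
    ring
  rw [hZ3] at hZ2
  have hcW : c * W = π.real B := by rw [hc]; field_simp
  calc π.real B ^ 2 = (2 * c * π.real B - c ^ 2 * W) * W := by rw [← hcW]; ring
    _ ≤ _ := by gcongr; linarith

variable [SecondCountableTopology E]

theorem integrable_id_tilted (hlam : 0 < lam) :
    Integrable (fun x => x) (π.tilted fun x => -lam * ‖x - y‖ ^ 2) := by
  have := isProbabilityMeasure_tilted (integrable_exp_neg_sq_norm π y hlam)
  refine (((integrable_exp_sq_norm_tilted π 0 y hlam).const_mul (4 / lam)).add
    (integrable_const 1)).mono' measurable_id.aestronglyMeasurable (ae_of_all _ fun x => ?_)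
  have h1 := Real.add_one_le_exp (lam / 4 * ‖x - 0‖ ^ 2)
  rw [sub_zero] at h1
  simp only [Pi.add_apply, sub_zero]
  have h2 : ‖x‖ ^ 2 ≤ 4 / lam * Real.exp (lam / 4 * ‖x‖ ^ 2) := by
    calc ‖x‖ ^ 2 = 4 / lam * (lam / 4 * ‖x‖ ^ 2) := by field_simp
      _ ≤ _ := by gcongr; linarith
  nlinarith [sq_nonneg (‖x‖ - 1), norm_nonneg x]

variable [NormedSpace ℝ E]

/-- Jensen bounds the exponential by a quotient with denominator `Z`, and
`sq_measureReal_closedBall_le` bounds π(B)² by a product with factor `Z`. Multiplying removes `Z`,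
leaving two integrals against the fixed measure `π`. -/
theorem exp_sq_norm_tilted_mean_le [CompleteSpace E] (hlam : 0 < lam) (r : ℝ) :
    Real.exp (lam / 4 * ‖∫ x, x ∂(π.tilted fun x => -lam * ‖x - y‖ ^ 2) - x₀‖ ^ 2) *
      π.real (Metric.closedBall x₀ r) ^ 2 ≤
      (∫ x, Real.exp (lam / 4 * ‖x - x₀‖ ^ 2 + -lam * ‖x - y‖ ^ 2) ∂π) *
        ∫ x in Metric.closedBall x₀ r, Real.exp (lam * ‖x - y‖ ^ 2) ∂π := by
  have hprob := isProbabilityMeasure_tilted (integrable_exp_neg_sq_norm π y hlam)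
  have h1 := (convexOn_exp_sq_norm_sub x₀ (by positivity : 0 ≤ lam / 4)).map_integral_le
    (Continuous.continuousOn (by fun_prop)) isClosed_univ
    (ae_of_all _ fun _ => Set.mem_univ _) (integrable_id_tilted π y hlam)
    (integrable_exp_sq_norm_tilted π x₀ y hlam)
  have h2 := sq_measureReal_closedBall_le π x₀ y hlam r
  set Z := ∫ x, Real.exp (-lam * ‖x - y‖ ^ 2) ∂π with hZ
  have hZpos : 0 < Z := integral_exp_pos (integrable_exp_neg_sq_norm π y hlam)
  have h3 : ∫ x, Real.exp (lam / 4 * ‖x - x₀‖ ^ 2) ∂(π.tilted fun x => -lam * ‖x - y‖ ^ 2) =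
      (∫ x, Real.exp (lam / 4 * ‖x - x₀‖ ^ 2 + -lam * ‖x - y‖ ^ 2) ∂π) / Z := by
    rw [integral_tilted, ← integral_div]
    refine integral_congr_ae (ae_of_all _ fun x => ?_)
    simp only [smul_eq_mul]
    rw [Real.exp_add]
    ring
  rw [h3] at h1
  set P := ∫ x, Real.exp (lam / 4 * ‖x - x₀‖ ^ 2 + -lam * ‖x - y‖ ^ 2) ∂π
  have hP : 0 ≤ P := integral_nonneg fun _ => (Real.exp_pos _).le
  calc _ ≤ P / Z * (Z * ∫ x in Metric.closedBall x₀ r, Real.exp (lam * ‖x - y‖ ^ 2) ∂π) := by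
        gcongr
    _ = _ := by field_simp

/-- A PAC-Bayesian oracle inequality in terms of the prior mass of balls around the target `x₀`,
from an exponential moment bound on the differences of the losses. -/
theorem measureReal_tilted_mean_le [CompleteSpace E] {Ω : Type*} [MeasurableSpace Ω] {μ : Measure Ω}
    [IsProbabilityMeasure μ] {X : Ω → E} (hX : Measurable X) (hlam : 0 < lam)
    (hX' : ∀ ν ν', ∫⁻ ω, ENNReal.ofReal (Real.exp (lam / 4 * ‖ν - x₀‖ ^ 2 +
        -lam * ‖ν - X ω‖ ^ 2)) * ENNReal.ofReal (Real.exp (lam * ‖ν' - X ω‖ ^ 2)) ∂μ ≤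
      ENNReal.ofReal (Real.exp (5 / 2 * lam * ‖ν' - x₀‖ ^ 2)))
    {r : ℝ} (hB : 0 < π.real (Metric.closedBall x₀ r)) {ε : ℝ} (hε : 0 < ε) :
    1 - ε ≤ μ.real {ω |
      ‖∫ ν, ν ∂(π.tilted fun ν => -lam * ‖ν - X ω‖ ^ 2) - x₀‖ ^ 2 ≤
      10 * r ^ 2 + 4 / lam *
        (Real.log (1 / ε) + Real.log (1 / π.real (Metric.closedBall x₀ r)))} := by
  set B := Metric.closedBall x₀ r
  have hBm : MeasurableSet B := Metric.isClosed_closedBall.measurableSet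
  let F : E → E → ENNReal := fun x ν =>
    ENNReal.ofReal (Real.exp (lam / 4 * ‖ν - x₀‖ ^ 2 + -lam * ‖ν - x‖ ^ 2))
  let G : E → E → ENNReal := fun x ν =>
    ENNReal.ofReal (Real.exp (lam * ‖ν - x‖ ^ 2))
  -- As a double integral, the product admits a swap with the expectation over the data, where the
  -- moment bound `hX'` holds for each fixed pair of points.
  let Y : Ω → ENNReal := fun ω => ∫⁻ z, F (X ω) z.1 * G (X ω) z.2 ∂(π.prod (π.restrict B))
  have hFG : Measurable fun p : Ω × (E × E) =>
      F (X p.1) p.2.1 * G (X p.1) p.2.2 := by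
    simp only [F, G]
    fun_prop
  have hY : Measurable Y := hFG.lintegral_prod_right'
  have hEY : ∫⁻ ω, Y ω ∂μ ≤ ENNReal.ofReal (Real.exp (5 / 2 * lam * r ^ 2) * π.real B) := by
    simp only [Y]
    rw [lintegral_lintegral_swap hFG.aemeasurable]
    calc ∫⁻ z, ∫⁻ ω, F (X ω) z.1 * G (X ω) z.2 ∂μ ∂(π.prod (π.restrict B))
        ≤ ∫⁻ z, ENNReal.ofReal (Real.exp (5 / 2 * lam * ‖z.2 - x₀‖ ^ 2)) ∂(π.prod (π.restrict B)) :=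
          lintegral_mono fun z => hX' z.1 z.2
      _ = ∫⁻ ν in B, ENNReal.ofReal (Real.exp (5 / 2 * lam * ‖ν - x₀‖ ^ 2)) ∂π := by
          rw [lintegral_prod _ (Measurable.aemeasurable (by fun_prop))]
          simp
      _ ≤ ∫⁻ ν in B, ENNReal.ofReal (Real.exp (5 / 2 * lam * r ^ 2)) ∂π := by
          refine setLIntegral_mono measurable_const fun ν hν => ?_
          have := mem_closedBall_iff_norm.1 hν
          gcongr
      _ = _ := by
          rw [setLIntegral_const, ENNReal.ofReal_mul (Real.exp_pos _).le, ofReal_measureReal]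
  -- Markov's threshold: the bound on the mean of `Y`, divided by `ε`. Dividing it by π(B)² later
  -- leaves a single 1/π(B).
  set c := Real.exp (5 / 2 * lam * r ^ 2) * π.real B / ε with hc
  have hcpos : 0 < c := by positivity
  have hbad : μ.real {ω | ENNReal.ofReal c ≤ Y ω} ≤ ε := by
    have h1 := (mul_meas_ge_le_lintegral₀ hY.aemeasurable (ENNReal.ofReal c)).trans hEY
    rw [← ofReal_measureReal, ← ENNReal.ofReal_mul hcpos.le,
      ENNReal.ofReal_le_ofReal_iff (by positivity)] at h1
    have h2 : Real.exp (5 / 2 * lam * r ^ 2) * π.real B = c * ε := by rw [hc]; field_simp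
    rw [h2] at h1
    exact le_of_mul_le_mul_left h1 hcpos
  have hmeas : MeasurableSet {ω | ENNReal.ofReal c ≤ Y ω} := measurableSet_le measurable_const hY
  have hgood := probReal_compl_eq_one_sub (μ := μ) hmeas
  refine (by linarith : 1 - ε ≤ μ.real {ω | ENNReal.ofReal c ≤ Y ω}ᶜ).trans
    (measureReal_mono fun ω hω => ?_)
  simp only [Set.mem_compl_iff, Set.mem_ofPred_eq, not_le] at hω
  have hdet := exp_sq_norm_tilted_mean_le π x₀ (X ω) hlam r
  have hYω : Y ω = ENNReal.ofReal
      ((∫ x, Real.exp (lam / 4 * ‖x - x₀‖ ^ 2 + -lam * ‖x - X ω‖ ^ 2) ∂π) *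
        ∫ x in B, Real.exp (lam * ‖x - X ω‖ ^ 2) ∂π) := by
    rw [ENNReal.ofReal_mul (integral_nonneg fun _ => (Real.exp_pos _).le),
      ofReal_integral_eq_lintegral_ofReal (integrable_exp_sq_norm_mul π x₀ (X ω) hlam)
        (ae_of_all _ fun _ => (Real.exp_pos _).le),
      ofReal_integral_eq_lintegral_ofReal (integrableOn_exp_sq_norm_closedBall π x₀ (X ω) hlam r)
        (ae_of_all _ fun _ => (Real.exp_pos _).le)]
    refine lintegral_prod_mul (f := F (X ω)) (g := G (X ω)) ?_ ?_ <;>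
      exact Measurable.aemeasurable (by simp only [F, G]; fun_prop)
  rw [hYω, ENNReal.ofReal_lt_ofReal_iff hcpos] at hω
  have hlt := hdet.trans_lt hω
  set T := ‖∫ ν, ν ∂(π.tilted fun ν => -lam * ‖ν - X ω‖ ^ 2) - x₀‖ ^ 2
  have h5 : Real.exp (lam / 4 * T) ≤
      Real.exp (5 / 2 * lam * r ^ 2 + (Real.log (1 / ε) + Real.log (1 / π.real B))) := by
    rw [Real.exp_add, Real.exp_add, Real.exp_log (by positivity), Real.exp_log (by positivity)]
    refine ((lt_div_iff₀ (by positivity)).2 hlt).le.trans (le_of_eq ?_)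
    rw [hc]
    field_simp
    exact div_self (by positivity)
  rw [Real.exp_le_exp] at h5
  change T ≤ _
  calc T = 4 / lam * (lam / 4 * T) := by field_simp
    _ ≤ 4 / lam * (5 / 2 * lam * r ^ 2 + (Real.log (1 / ε) + Real.log (1 / π.real B))) := by gcongr
    _ = _ := by field_simp; ring

end Jensen

/-! ### The PAC-Bayesian bound for linear inversion -/

section PacBayes

/-- The topology meant here is that of the Frobenius norm, which unfolds to the entrywise product
topology. -/
instance instBorelSpaceQMatrix (n : ℕ) :
    @BorelSpace (QMatrix n) PseudoMetricSpace.toUniformSpace.toTopologicalSpace _ :=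
  inferInstanceAs (BorelSpace (Idx n → Idx n → ℂ))

instance instSecondCountableTopologyQMatrix (n : ℕ) :
    @SecondCountableTopology (QMatrix n) PseudoMetricSpace.toUniformSpace.toTopologicalSpace :=
  inferInstanceAs (SecondCountableTopology (Idx n → Idx n → ℂ))

instance instDiscreteMeasurableSpaceData (n m : ℕ) :
    DiscreteMeasurableSpace (Fin m → Setting n → Outcome n) :=
  have : Countable (Fin m → Setting n → Outcome n) := Finite.to_countable
  inferInstance

variable {Ω : Type*} [MeasurableSpace Ω] {μ : Measure Ω} [IsProbabilityMeasure μ] {n m : ℕ}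
  {ρ : QMatrix n} {R : Fin m → Setting n → Ω → Outcome n}

/-- The weights 3/2 and 3 are chosen so that, after multiplication by `lam / 2`, the first term
exactly cancels the available -(3/4) `lam` ‖ν - ρ‖², and the second adds up to 5/2 `lam`. -/
theorem sq_norm_sub_le {n : ℕ} (A B : QMatrix n) :
    ‖A - B‖ ^ 2 ≤ 3 / 2 * ‖A‖ ^ 2 + 3 * ‖B‖ ^ 2 := by
  have h := norm_sub_le A B
  have h2 : ‖A - B‖ ^ 2 ≤ (‖A‖ + ‖B‖) ^ 2 := by gcongr
  nlinarith [sq_nonneg (‖A‖ - 2 * ‖B‖)]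

theorem lintegral_exp_sq_norm_difference_le (hm : 0 < m) (hR : IsCompleteData μ ρ R) {lam : ℝ}
    (hlam : lam = m * 3 ^ n / (4 * 5 ^ n)) (ν ν' : QMatrix n) :
    ∫⁻ ω, ENNReal.ofReal (Real.exp (lam / 4 * ‖ν - ρ‖ ^ 2 +
        -lam * ‖ν - linearInversion (empFreq fun i a => R i a ω)‖ ^ 2)) *
      ENNReal.ofReal (Real.exp (lam * ‖ν' - linearInversion (empFreq fun i a => R i a ω)‖ ^ 2)) ∂μ ≤
      ENNReal.ofReal (Real.exp (5 / 2 * lam * ‖ν' - ρ‖ ^ 2)) := by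
  have hlam0 : 0 < lam := by rw [hlam]; positivity
  -- The two losses have opposite signs, so the square of the error of linear inversion cancels.
  -- What remains is deterministic apart from a term linear in the error.
  have key : ∀ ω, ENNReal.ofReal (Real.exp (lam / 4 * ‖ν - ρ‖ ^ 2 +
        -lam * ‖ν - linearInversion (empFreq fun i a => R i a ω)‖ ^ 2)) *
      ENNReal.ofReal (Real.exp (lam * ‖ν' - linearInversion (empFreq fun i a => R i a ω)‖ ^ 2)) =
      ENNReal.ofReal (Real.exp (-(3 / 4 * lam) * ‖ν - ρ‖ ^ 2 + lam * ‖ν' - ρ‖ ^ 2)) *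
      ENNReal.ofReal (Real.exp ((2 * lam) * frobRe ((ν - ρ) - (ν' - ρ))
        (linearInversion (empFreq fun i a => R i a ω) - ρ))) := by
    intro ω
    set X := linearInversion (empFreq fun i a => R i a ω)
    rw [← ENNReal.ofReal_mul (Real.exp_pos _).le, ← ENNReal.ofReal_mul (Real.exp_pos _).le,
      ← Real.exp_add, ← Real.exp_add]
    congr 2
    rw [← sub_sub_sub_cancel_right ν X ρ, ← sub_sub_sub_cancel_right ν' X ρ, sq_norm_sub (ν - ρ),
      sq_norm_sub (ν' - ρ), frobRe_sub_left (ν - ρ)]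
    ring
  simp only [key]
  rw [lintegral_const_mul' _ _ ENNReal.ofReal_ne_top]
  refine (mul_le_mul_right (lintegral_exp_frobRe_error_le hm hR _ _) _).trans ?_
  rw [← ENNReal.ofReal_mul (Real.exp_pos _).le, ← Real.exp_add]
  refine ENNReal.ofReal_le_ofReal (Real.exp_le_exp.2 ?_)
  -- Here the choice of `lam` enters: its factor 5^n outweighs the 2^n of the variance proxy.
  have h1 : (2 * lam) ^ 2 / 2 * (2 ^ n / (m * 3 ^ n)) = lam / 2 * (2 / 5) ^ n := by
    have hm' : (0 : ℝ) < m := by positivity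
    rw [hlam, div_pow]
    field_simp
    norm_num
  have h2 : (2 / 5 : ℝ) ^ n ≤ 1 := pow_le_one₀ (by norm_num) (by norm_num)
  rw [h1]
  have h3 : lam / 2 * (2 / 5) ^ n * ‖ν - ρ - (ν' - ρ)‖ ^ 2 ≤
      lam / 2 * 1 * (3 / 2 * ‖ν - ρ‖ ^ 2 + 3 * ‖ν' - ρ‖ ^ 2) := by
    gcongr
    exact sq_norm_sub_le _ _
  linarith

theorem pac_bayes (hm : 0 < m) (hR : IsCompleteData μ ρ R) {lam : ℝ}
    (hlam : lam = m * 3 ^ n / (4 * 5 ^ n)) (π : Measure (QMatrix n)) [IsProbabilityMeasure π]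
    {r : ℝ} (hB : 0 < π.real (Metric.closedBall ρ r)) {ε : ℝ} (hε : 0 < ε) :
    1 - ε ≤ μ.real {ω |
      ‖∫ ν, ν ∂(π.tilted fun ν =>
        -lam * ‖ν - linearInversion (empFreq fun i a => R i a ω)‖ ^ 2) - ρ‖ ^ 2 ≤
      10 * r ^ 2 + 4 / lam *
        (Real.log (1 / ε) + Real.log (1 / π.real (Metric.closedBall ρ r)))} := by
  have hX : Measurable fun ω => linearInversion (empFreq fun i a => R i a ω) := by
    have h1 : Measurable fun ω => (fun i a => R i a ω : Fin m → Setting n → Outcome n) :=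
      measurable_pi_lambda _ fun i => measurable_pi_lambda _ fun a => hR.measurable i a
    have h2 : Measurable fun D : Fin m → Setting n → Outcome n => linearInversion (empFreq D) :=
      .of_discrete
    exact h2.comp h1
  exact measureReal_tilted_mean_le π ρ hX (by rw [hlam]; positivity)
    (fun ν ν' => lintegral_exp_sq_norm_difference_le hm hR hlam ν ν') hB hε

end PacBayes

/-! ### Prior mass of balls around low-rank states -/

/-! ### Spherical caps -/

section Sphere

open scoped Pointwise

variable {E : Type*} [NormedAddCommGroup E]

theorem measurableSet_cap [MeasurableSpace E] [BorelSpace E] (u : E) (δ : ℝ) :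
    MeasurableSet {V : Metric.sphere (0 : E) 1 | ‖(V : E) - u‖ ≤ δ} :=
  (isClosed_le (by fun_prop) continuous_const).measurableSet

variable [NormedSpace ℝ E]

/-- Radial projection sends a point near u/2 close to `u`: such a point has norm at least 1/4, and
two errors of δ/8 divided by it give at most `δ`. The surface measure of a cap is the dimension
times the volume of its cone, so a ball inside the cone bounds the cap from below. -/
theorem ball_subset_smul_cap (u : E) (hu : ‖u‖ = 1) {δ : ℝ} (hδ1 : δ ≤ 1) :
    Metric.ball ((1 / 2 : ℝ) • u) (δ / 8) ⊆
      Set.Ioo (0 : ℝ) 1 • Set.image Subtype.val {V : Metric.sphere (0 : E) 1 | ‖(V : E) - u‖ ≤ δ} := by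
  intro x hx
  rw [mem_ball_iff_norm] at hx
  have h1 : |‖x‖ - 1 / 2| ≤ ‖x - (1 / 2 : ℝ) • u‖ := by
    have h := abs_norm_sub_norm_le x ((1 / 2 : ℝ) • u)
    rwa [norm_smul, hu, Real.norm_of_nonneg (by norm_num), mul_one] at h
  have h2 := abs_le.1 (h1.trans hx.le)
  have hpos : 0 < ‖x‖ := by linarith
  refine Set.mem_smul.2 ⟨‖x‖, ⟨hpos, by linarith⟩, ‖x‖⁻¹ • x, ⟨⟨‖x‖⁻¹ • x, ?_⟩, ?_, rfl⟩, ?_⟩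
  · rw [mem_sphere_zero_iff_norm, norm_smul, norm_inv, norm_norm, inv_mul_cancel₀ hpos.ne']
  · change ‖‖x‖⁻¹ • x - u‖ ≤ δ
    have h3 : ‖x‖⁻¹ • x - u = ‖x‖⁻¹ • ((x - (1 / 2 : ℝ) • u) - (‖x‖ - 1 / 2) • u) := by
      rw [sub_sub, ← add_smul, smul_sub, smul_smul, add_sub_cancel, inv_mul_cancel₀ hpos.ne',
        one_smul]
    rw [h3, norm_smul, norm_inv, norm_norm, inv_mul_le_iff₀ hpos]
    calc _ ≤ ‖x - (1 / 2 : ℝ) • u‖ + ‖(‖x‖ - 1 / 2) • u‖ := norm_sub_le _ _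
      _ ≤ δ / 8 + δ / 8 := by
        rw [norm_smul, hu, mul_one, Real.norm_eq_abs]
        exact add_le_add hx.le (h1.trans hx.le)
      _ ≤ ‖x‖ * δ := by nlinarith
  · rw [smul_smul, mul_inv_cancel₀ hpos.ne', one_smul]

theorem le_toSphere_cap [MeasurableSpace E] [BorelSpace E] [FiniteDimensional ℝ E] [Nontrivial E]
    (μ : Measure E) [μ.IsAddHaarMeasure] (u : E) (hu : ‖u‖ = 1) {δ : ℝ} (hδ : 0 < δ)
    (hδ1 : δ ≤ 1) :
    ENNReal.ofReal ((δ / 8) ^ Module.finrank ℝ E) * μ.toSphere Set.univ ≤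
      μ.toSphere {V : Metric.sphere (0 : E) 1 | ‖(V : E) - u‖ ≤ δ} := by
  rw [μ.toSphere_apply' (measurableSet_cap u δ), μ.toSphere_apply_univ, mul_left_comm,
    ← μ.addHaar_ball ((1 / 2 : ℝ) • u) (by positivity)]
  gcongr
  exact ball_subset_smul_cap u hu hδ1

instance isProbabilityMeasure_uniformSphere (n : ℕ) : IsProbabilityMeasure (uniformSphere n) := by
  refine ⟨?_⟩
  rw [uniformSphere, Measure.smul_apply, smul_eq_mul]
  refine ENNReal.inv_mul_cancel ?_ (measure_ne_top _ _)
  rw [Ne, Measure.measure_univ_eq_zero]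
  exact Measure.toSphere_ne_zero _

theorem finrank_real_stateSpace (n : ℕ) :
    Module.finrank ℝ (EuclideanSpace ℂ (Idx n)) = 2 * 2 ^ n := by
  rw [finrank_real_of_complex, finrank_euclideanSpace]
  simp

theorem le_uniformSphere_cap {n : ℕ} (u : EuclideanSpace ℂ (Idx n)) (hu : ‖u‖ = 1) {δ : ℝ}
    (hδ : 0 < δ) (hδ1 : δ ≤ 1) :
    (δ / 8) ^ (2 * 2 ^ n) ≤
      (uniformSphere n).real {V : USphere n | ‖(V : EuclideanSpace ℂ (Idx n)) - u‖ ≤ δ} := by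
  have h := le_toSphere_cap (volume : Measure (EuclideanSpace ℂ (Idx n))) u hu hδ hδ1
  rw [finrank_real_stateSpace] at h
  rw [measureReal_def, ← ENNReal.ofReal_le_iff_le_toReal (measure_ne_top _ _), uniformSphere,
    Measure.smul_apply, smul_eq_mul, mul_comm (_ : ENNReal)⁻¹, ← div_eq_mul_inv,
    ENNReal.le_div_iff_mul_le (Or.inr ?_) (Or.inl (measure_ne_top _ _))]
  · exact h
  · exact fun h0 => by
      rw [h0, nonpos_iff_eq_zero, mul_eq_zero, Measure.measure_univ_eq_zero] at h
      rcases h with h | h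
      · rw [ENNReal.ofReal_eq_zero] at h
        exact absurd h (not_le.2 (by positivity))
      · exact Measure.toSphere_ne_zero _ h

end Sphere

/-! ### ℓ¹ balls under the Dirichlet distribution -/

section Dirichlet

/-- Convexity of Γ between 1 and 2 gives Γ(a + 1) ≤ 1, so 1/Γ(a) ≥ a. On (0, 2] the factor t^(a - 1)
is at least 2^(a - 1) ≥ 1/2 because a ≤ 1, and exp(-t) ≥ exp(-2). -/
theorem le_gammaMeasure_Ioc {a x η : ℝ} (ha : 0 < a) (ha1 : a ≤ 1) (hx : 0 ≤ x)
    (hxη : x + η ≤ 2) :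
    a * η * (Real.exp (-2) / 2) ≤ (gammaMeasure a 1).real (Set.Ioc x (x + η)) := by
  have := isProbabilityMeasure_gammaMeasure ha one_pos
  have hΓ : Real.Gamma (a + 1) ≤ 1 := by
    have h := Real.convexOn_Gamma.2 (by simp : (1 : ℝ) ∈ Set.Ioi 0) (by simp : (2 : ℝ) ∈ Set.Ioi 0)
      (by linarith : 0 ≤ 1 - a) ha.le (by ring)
    simp only [smul_eq_mul, Real.Gamma_one, Real.Gamma_two] at h
    rw [show (1 - a) * 1 + a * 2 = a + 1 by ring] at h
    linarith
  have hΓ' : a ≤ 1 / Real.Gamma a := by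
    rw [Real.Gamma_add_one ha.ne'] at hΓ
    rwa [le_div_iff₀ (Real.Gamma_pos_of_pos ha)]
  have hpdf : ∀ t ∈ Set.Ioc x (x + η), ENNReal.ofReal (a * (Real.exp (-2) / 2)) ≤
      gammaPDF a 1 t := by
    intro t ht
    have ht0 : 0 < t := hx.trans_lt ht.1
    have ht2 : t ≤ 2 := ht.2.trans hxη
    rw [gammaPDF_of_nonneg ht0.le]
    refine ENNReal.ofReal_le_ofReal ?_
    have h1 : (1 / 2 : ℝ) ≤ t ^ (a - 1) := by
      calc (1 / 2 : ℝ) = 2 ^ (-1 : ℝ) := by rw [Real.rpow_neg_one]; norm_num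
        _ ≤ 2 ^ (a - 1) := Real.rpow_le_rpow_of_exponent_le (by norm_num) (by linarith)
        _ ≤ _ := Real.rpow_le_rpow_of_nonpos ht0 ht2 (by linarith)
    rw [Real.one_rpow, one_mul]
    calc a * (Real.exp (-2) / 2) = a * (1 / 2) * Real.exp (-2) := by ring
      _ ≤ 1 / Real.Gamma a * t ^ (a - 1) * Real.exp (-t) := by gcongr
  rw [measureReal_def, ← ENNReal.ofReal_le_iff_le_toReal (measure_ne_top _ _), gammaMeasure,
    withDensity_apply _ measurableSet_Ioc]
  calc ENNReal.ofReal (a * η * (Real.exp (-2) / 2))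
      = ∫⁻ t in Set.Ioc x (x + η), ENNReal.ofReal (a * (Real.exp (-2) / 2)) := by
        rw [setLIntegral_const, Real.volume_Ioc, add_sub_cancel_left,
          ← ENNReal.ofReal_mul (by positivity)]
        congr 1
        ring
    _ ≤ _ := setLIntegral_mono' measurableSet_Ioc hpdf

variable {ι : Type*} [Fintype ι]

theorem measurable_normalize : Measurable fun (g : ι → ℝ) i => g i / ∑ k, g k := by
  fun_prop

theorem isProbabilityMeasure_dirichlet {α : ι → ℝ} (hα : ∀ i, 0 < α i) :
    IsProbabilityMeasure (dirichlet α) := by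
  have := fun i => isProbabilityMeasure_gammaMeasure (hα i) one_pos
  exact Measure.isProbabilityMeasure_map measurable_normalize.aemeasurable

/-- One-sided windows above `p` force S ≥ 1, so normalization only decreases the entries. The two
nonnegative deviations, from normalizing and from the window, each sum to S - 1. -/
theorem sum_abs_normalize_sub_le {p g : ι → ℝ} {η : ℝ} (hp : ∀ i, 0 ≤ p i) (hp1 : ∑ i, p i = 1)
    (hg : ∀ i, g i ∈ Set.Ioc (p i) (p i + η)) :
    ∑ i, |g i / ∑ k, g k - p i| ≤ 2 * Fintype.card ι * η := by
  set S := ∑ k, g k with hS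
  have h1 : 1 ≤ S := by rw [← hp1]; exact Finset.sum_le_sum fun i _ => (hg i).1.le
  have h2 : S ≤ 1 + Fintype.card ι * η := by
    calc S ≤ ∑ i, (p i + η) := Finset.sum_le_sum fun i _ => (hg i).2
      _ = _ := by simp [Finset.sum_add_distrib, hp1]
  have h3 : ∀ i, |g i / S - p i| ≤ (g i - g i / S) + (g i - p i) := by
    intro i
    have h4 : g i / S ≤ g i := div_le_self ((hp i).trans (hg i).1.le) h1
    have h5 := (hg i).1
    rw [abs_le]
    constructor <;> linarith
  calc _ ≤ ∑ i, ((g i - g i / S) + (g i - p i)) := Finset.sum_le_sum fun i _ => h3 i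
    _ = (S - S / S) + (S - 1) := by
      simp only [Finset.sum_add_distrib, Finset.sum_sub_distrib, ← Finset.sum_div, hp1, ← hS]
    _ ≤ _ := by rw [div_self (by linarith)]; linarith

/-- It suffices that each independent gamma variable lands in its window above `p i`; the Dirichlet
density is not needed. -/
theorem le_dirichlet_l1_ball {α p : ι → ℝ} {η : ℝ} (hα : ∀ i, 0 < α i) (hα1 : ∀ i, α i ≤ 1)
    (hp : ∀ i, 0 ≤ p i) (hp1 : ∑ i, p i = 1) (hη : 0 < η) (hη1 : η ≤ 1) :
    (∏ i, α i) * (η * (Real.exp (-2) / 2)) ^ Fintype.card ι ≤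
      (dirichlet α).real {γ | ∑ i, |γ i - p i| ≤ 2 * Fintype.card ι * η} := by
  have := fun i => isProbabilityMeasure_gammaMeasure (hα i) one_pos
  have hmeas : MeasurableSet {γ : ι → ℝ | ∑ i, |γ i - p i| ≤ 2 * Fintype.card ι * η} :=
    (isClosed_le (by fun_prop) continuous_const).measurableSet
  rw [dirichlet, map_measureReal_apply measurable_normalize hmeas]
  have hle : ∀ i, p i ≤ 1 := fun i =>
    hp1 ▸ Finset.single_le_sum (fun j _ => hp j) (Finset.mem_univ i)
  calc _ = ∏ i, (α i * η * (Real.exp (-2) / 2)) := by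
        simp only [mul_assoc, Finset.prod_mul_distrib, Finset.prod_const, Finset.card_univ, mul_pow]
    _ ≤ ∏ i, (gammaMeasure (α i) 1).real (Set.Ioc (p i) (p i + η)) :=
        Finset.prod_le_prod (fun i _ => by have := hα i; positivity) fun i _ =>
          le_gammaMeasure_Ioc (hα i) (hα1 i) (hp i) (by linarith [hle i])
    _ = (Measure.pi fun i => gammaMeasure (α i) 1).real
          (Set.univ.pi fun i => Set.Ioc (p i) (p i + η)) := by
        rw [measureReal_def, Measure.pi_pi, ENNReal.toReal_prod]
        rfl
    _ ≤ _ := measureReal_mono fun g hg =>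
        sum_abs_normalize_sub_le hp hp1 fun i => hg i (Set.mem_univ i)

end Dirichlet

/-! ### From weights and vectors to density matrices -/

section Mixture

variable {n : ℕ}

/-- The rank-one matrix `v v†`. -/
noncomputable def outer (v : EuclideanSpace ℂ (Idx n)) : QMatrix n :=
  Matrix.vecMulVec v.ofLp (star v.ofLp)

theorem norm_vecMulVec (v w : EuclideanSpace ℂ (Idx n)) :
    ‖(Matrix.vecMulVec v.ofLp (star w.ofLp) : QMatrix n)‖ = ‖v‖ * ‖w‖ := by
  rw [← sq_eq_sq₀ (norm_nonneg _) (by positivity), mul_pow, sq_norm_eq_sum,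
    EuclideanSpace.norm_sq_eq, EuclideanSpace.norm_sq_eq, Finset.sum_mul_sum]
  simp [Matrix.vecMulVec_apply, mul_pow]

theorem norm_outer_sub_le (v w : EuclideanSpace ℂ (Idx n)) (hv : ‖v‖ = 1) (hw : ‖w‖ = 1) :
    ‖outer v - outer w‖ ≤ 2 * ‖v - w‖ := by
  have h : outer v - outer w = Matrix.vecMulVec (v - w).ofLp (star v.ofLp) +
      Matrix.vecMulVec w.ofLp (star (v - w).ofLp) := by
    ext i j
    simp only [outer, Matrix.sub_apply, Matrix.add_apply, Matrix.vecMulVec_apply, Pi.star_apply,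
      star_sub, WithLp.ofLp_sub, Pi.sub_apply]
    ring
  rw [h]
  refine (norm_add_le _ _).trans ?_
  rw [norm_vecMulVec, norm_vecMulVec, hv, hw]
  linarith

theorem mixture_eq_sum_outer (γ : Fin (2 ^ n) → ℝ) (V : Fin (2 ^ n) → USphere n) :
    mixture γ V = ∑ i, (γ i : ℂ) • outer (V i : EuclideanSpace ℂ (Idx n)) := rfl

theorem norm_ofReal_smul (c : ℝ) (M : QMatrix n) : ‖(c : ℂ) • M‖ = |c| * ‖M‖ := by
  rw [norm_smul, Complex.norm_real, Real.norm_eq_abs]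

/-- When p = 0 the vector `v` is unconstrained and only the weight error counts; this is the source
of the dependence on the rank. -/
theorem norm_weighted_outer_sub_le {v w : EuclideanSpace ℂ (Idx n)} (hv : ‖v‖ = 1) (hw : ‖w‖ = 1)
    {c p δ : ℝ} (hp : 0 ≤ p) (h : p ≠ 0 → ‖v - w‖ ≤ δ) :
    ‖(c : ℂ) • outer v - (p : ℂ) • outer w‖ ≤ |c - p| + p * (2 * δ) := by
  have h1 : (c : ℂ) • outer v - (p : ℂ) • outer w =
      ((c - p : ℝ) : ℂ) • outer v + (p : ℂ) • (outer v - outer w) := by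
    rw [smul_sub, Complex.ofReal_sub, sub_smul, sub_add_sub_cancel]
  have h2 : ‖outer v‖ = 1 := by rw [outer, norm_vecMulVec, hv, one_mul]
  have h3 : p * ‖outer v - outer w‖ ≤ p * (2 * δ) := by
    by_cases hp0 : p = 0
    · simp [hp0]
    · have h4 := norm_outer_sub_le v w hv hw
      have h5 := h hp0
      exact mul_le_mul_of_nonneg_left (by linarith) hp
  rw [h1]
  refine (norm_add_le _ _).trans ?_
  rw [norm_ofReal_smul, norm_ofReal_smul, h2, mul_one, abs_of_nonneg hp]
  linarith

theorem norm_mixture_sub_le {γ p : Fin (2 ^ n) → ℝ} {V : Fin (2 ^ n) → USphere n}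
    {u : Fin (2 ^ n) → EuclideanSpace ℂ (Idx n)} (hu : ∀ i, ‖u i‖ = 1) {δ : ℝ}
    (hp : ∀ i, 0 ≤ p i) (hp1 : ∑ i, p i = 1)
    (hV : ∀ i, p i ≠ 0 → ‖(V i : EuclideanSpace ℂ (Idx n)) - u i‖ ≤ δ) :
    ‖mixture γ V - ∑ i, (p i : ℂ) • outer (u i)‖ ≤ ∑ i, |γ i - p i| + 2 * δ := by
  rw [mixture_eq_sum_outer, ← Finset.sum_sub_distrib]
  refine (norm_sum_le_of_le _ fun i _ => norm_weighted_outer_sub_le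
    (mem_sphere_zero_iff_norm.1 (V i).2) (hu i) (hp i) (hV i)).trans (le_of_eq ?_)
  rw [Finset.sum_add_distrib, ← Finset.sum_mul, hp1, one_mul]

theorem measurable_mixture :
    Measurable fun q : (Fin (2 ^ n) → ℝ) × (Fin (2 ^ n) → USphere n) => mixture q.1 q.2 := by
  refine measurable_pi_lambda _ fun k => measurable_pi_lambda _ fun l => ?_
  simp only [mixture, Matrix.sum_apply, Matrix.smul_apply, Matrix.vecMulVec_apply, smul_eq_mul,
    Pi.star_apply]
  refine Finset.measurable_sum _ fun i _ => ?_
  have hV : ∀ k, Measurable fun q : (Fin (2 ^ n) → ℝ) × (Fin (2 ^ n) → USphere n) =>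
      (q.2 i : EuclideanSpace ℂ (Idx n)).ofLp k := fun k => by fun_prop
  have hγ : Measurable fun q : (Fin (2 ^ n) → ℝ) × (Fin (2 ^ n) → USphere n) => q.1 i := by
    fun_prop
  exact (Complex.measurable_ofReal.comp hγ).mul ((hV k).mul (continuous_star.measurable.comp (hV l)))

theorem isProbabilityMeasure_prior {α : Fin (2 ^ n) → ℝ} (hα : ∀ i, 0 < α i) :
    IsProbabilityMeasure (prior n α) := by
  have := isProbabilityMeasure_dirichlet hα
  exact Measure.isProbabilityMeasure_map measurable_mixture.aemeasurable

/-- Spectral decomposition of a density matrix, indexed as the prior. -/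
theorem IsDensityMatrix.exists_eq_sum_outer {ρ : QMatrix n} (hρ : IsDensityMatrix ρ) :
    ∃ (p : Fin (2 ^ n) → ℝ) (u : Fin (2 ^ n) → EuclideanSpace ℂ (Idx n)),
      (∀ i, 0 ≤ p i) ∧ ∑ i, p i = 1 ∧ (∀ i, ‖u i‖ = 1) ∧
      (Finset.univ.filter fun i => p i ≠ 0).card = ρ.rank ∧
      ρ = ∑ i, (p i : ℂ) • outer (u i) := by
  have hH := hρ.posSemidef.isHermitian
  let e : Fin (2 ^ n) ≃ Idx n := Fintype.equivOfCardEq (by simp)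
  refine ⟨fun i => hH.eigenvalues (e i), fun i => hH.eigenvectorBasis (e i),
    fun i => hρ.posSemidef.eigenvalues_nonneg _, ?_, fun i => hH.eigenvectorBasis.norm_eq_one _,
    ?_, ?_⟩
  · rw [e.sum_comp fun i => hH.eigenvalues i]
    have h := hH.trace_eq_sum_eigenvalues
    rw [hρ.trace_eq_one] at h
    apply Complex.ofReal_injective
    simpa using h.symm
  · rw [hH.rank_eq_card_non_zero_eigs, Fintype.card_subtype]
    exact Finset.card_equiv e (by simp)
  · rw [e.sum_comp fun i => (hH.eigenvalues i : ℂ) • outer (hH.eigenvectorBasis i)]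
    conv_lhs => rw [hH.spectral_theorem]
    ext k l
    simp [Unitary.conjStarAlgAut_apply, Matrix.mul_apply, Matrix.sum_apply, outer,
      Matrix.vecMulVec_apply, Matrix.diagonal_apply, Matrix.star_apply, mul_assoc, mul_left_comm,
      Matrix.IsHermitian.eigenvectorUnitary_apply]

theorem le_prior_closedBall {α : Fin (2 ^ n) → ℝ} (hα : ∀ i, 0 < α i) (hα1 : ∀ i, α i ≤ 1)
    {ρ : QMatrix n} (hρ : IsDensityMatrix ρ) {η δ : ℝ} (hη : 0 < η) (hη1 : η ≤ 1) (hδ : 0 < δ)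
    (hδ1 : δ ≤ 1) :
    (∏ i, α i) * (η * (Real.exp (-2) / 2)) ^ (2 ^ n) * (δ / 8) ^ (2 * 2 ^ n * ρ.rank) ≤
      (prior n α).real (Metric.closedBall ρ (2 * 2 ^ n * η + 2 * δ)) := by
  obtain ⟨p, u, hp, hp1, hu, hrank, hdec⟩ := hρ.exists_eq_sum_outer
  have := isProbabilityMeasure_dirichlet hα
  let A : Set (Fin (2 ^ n) → ℝ) := {γ | ∑ i, |γ i - p i| ≤ 2 * 2 ^ n * η}
  -- For a zero eigenvalue this is the whole sphere, of mass 1.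
  let B : Fin (2 ^ n) → Set (USphere n) := fun i =>
    {V | p i ≠ 0 → ‖(V : EuclideanSpace ℂ (Idx n)) - u i‖ ≤ δ}
  have hA : (∏ i, α i) * (η * (Real.exp (-2) / 2)) ^ (2 ^ n) ≤ (dirichlet α).real A := by
    simpa using le_dirichlet_l1_ball hα hα1 hp hp1 hη hη1
  have hB : (δ / 8) ^ (2 * 2 ^ n * ρ.rank) ≤
      (Measure.pi fun _ : Fin (2 ^ n) => uniformSphere n).real (Set.univ.pi B) := by
    calc (δ / 8) ^ (2 * 2 ^ n * ρ.rank)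
        = ∏ i, if p i ≠ 0 then (δ / 8) ^ (2 * 2 ^ n) else 1 := by
          rw [Finset.prod_ite, Finset.prod_const, Finset.prod_const_one, hrank, mul_one, pow_mul]
      _ ≤ ∏ i, (uniformSphere n).real (B i) := by
          refine Finset.prod_le_prod (fun i _ => by split_ifs <;> positivity) fun i _ => ?_
          by_cases hi : p i = 0
          · simp [hi, B]
          · simpa [hi, B] using le_uniformSphere_cap (u i) (hu i) hδ hδ1
      _ = _ := by
          rw [measureReal_def, Measure.pi_pi, ENNReal.toReal_prod]
          rfl
  rw [prior, map_measureReal_apply measurable_mixture Metric.isClosed_closedBall.measurableSet]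
  calc _ ≤ (dirichlet α).real A *
        (Measure.pi fun _ : Fin (2 ^ n) => uniformSphere n).real (Set.univ.pi B) := by gcongr
    _ = ((dirichlet α).prod (Measure.pi fun _ : Fin (2 ^ n) => uniformSphere n)).real
          (A ×ˢ Set.univ.pi B) := (measureReal_prod_prod _ _).symm
    _ ≤ _ := measureReal_mono fun q hq => by
        have h := norm_mixture_sub_le (γ := q.1) (V := q.2) hu hp hp1
          fun i hi => hq.2 i (Set.mem_univ i) hi
        rw [← hdec] at h
        exact mem_closedBall_iff_norm.2 (h.trans (by gcongr; exact hq.1))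

end Mixture

/-! ### The dens-estimator -/

/-- Jensen's inequality needs the Bochner mean; entries are continuous linear functionals, so they
commute with it. -/
theorem densEstimator_eq_integral {n m : ℕ} {α : Fin (2 ^ n) → ℝ} (hα : ∀ i, 0 < α i) {lam : ℝ}
    (hlam : 0 < lam) (D : Fin m → Setting n → Outcome n) :
    densEstimator α lam D = ∫ ν, ν ∂((prior n α).tilted fun ν =>
      -lam * ‖ν - linearInversion (empFreq D)‖ ^ 2) := by
  have := isProbabilityMeasure_prior hα
  have hint := integrable_id_tilted (prior n α) (linearInversion (empFreq D)) hlam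
  ext i k
  let L : QMatrix n →L[ℝ] ℂ := LinearMap.toContinuousLinearMap (Matrix.entryLinearMap ℝ ℂ i k)
  exact L.integral_comp_comm hint

theorem IsDensityMatrix.rank_pos {n : ℕ} {ρ : QMatrix n} (hρ : IsDensityMatrix ρ) : 0 < ρ.rank := by
  obtain ⟨p, -, -, hp1, -, hrank, -⟩ := hρ.exists_eq_sum_outer
  rw [← hrank, Finset.card_pos]
  by_contra h
  rw [Finset.not_nonempty_iff_eq_empty, Finset.filter_eq_empty_iff] at h
  have h0 : ∑ i, p i = 0 := Finset.sum_eq_zero fun i hi => not_not.1 (h hi)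
  rw [h0] at hp1
  exact zero_ne_one hp1

/-- Lower bound for the prior mass of the ball of radius `1 / N` around a density matrix. -/
theorem neg_log_prior_closedBall_le {D₁ D₂ : ℝ} (hD₂ : 0 < D₂) {n : ℕ} {α : Fin (2 ^ n) → ℝ}
    (hα : PriorAssumption D₁ D₂ n α) {ρ : QMatrix n} (hρ : IsDensityMatrix ρ) {N : ℝ}
    (hN : 1 ≤ N) :
    0 < (prior n α).real (Metric.closedBall ρ (1 / N)) ∧
      Real.log (1 / (prior n α).real (Metric.closedBall ρ (1 / N))) ≤
        2 ^ n * ρ.rank * ((D₂ + 1) * Real.log (2 ^ n) + 3 * Real.log N + 12) := by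
  have hN0 : 0 < N := by linarith
  have hd1 : (1 : ℝ) ≤ 2 ^ n := one_le_pow₀ (by norm_num)
  have hd : (0 : ℝ) < 2 ^ n := by positivity
  -- Weights and vectors each contribute half of the radius 1/N.
  have h := le_prior_closedBall hα.pos hα.le_one hρ (η := 1 / (4 * 2 ^ n * N)) (δ := 1 / (4 * N))
    (by positivity) (by rw [div_le_one (by positivity)]; nlinarith) (by positivity)
    (by rw [div_le_one (by positivity)]; linarith)
  rw [show 2 * (2 : ℝ) ^ n * (1 / (4 * 2 ^ n * N)) + 2 * (1 / (4 * N)) = 1 / N by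
    field_simp; norm_num] at h
  have hlow : Real.exp (-D₂ * (2 : ℝ) ^ n * Real.log ((2 : ℝ) ^ n)) *
      (1 / (4 * 2 ^ n * N) * (Real.exp (-2) / 2)) ^ (2 ^ n) *
      (1 / (4 * N) / 8) ^ (2 * 2 ^ n * ρ.rank) ≤
      (prior n α).real (Metric.closedBall ρ (1 / N)) := by
    refine le_trans ?_ h
    gcongr
    exact hα.prod_ge
  have hpos : 0 < (prior n α).real (Metric.closedBall ρ (1 / N)) :=
    lt_of_lt_of_le (by positivity) hlow
  refine ⟨hpos, ?_⟩
  have hη : Real.log (1 / (4 * 2 ^ n * N) * (Real.exp (-2) / 2)) =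
      -(2 * Real.log 2 + Real.log (2 ^ n) + Real.log N + 2 + Real.log 2) := by
    rw [Real.log_mul (by positivity) (by positivity),
      Real.log_div (Real.exp_ne_zero _) (by positivity), Real.log_exp, one_div, Real.log_inv,
      Real.log_mul (by positivity) (by positivity),
      Real.log_mul (by positivity) (by positivity), show (4 : ℝ) = 2 ^ 2 by norm_num,
      Real.log_pow 2 2]
    push_cast
    ring
  have hδ : Real.log (1 / (4 * N) / 8) = -(5 * Real.log 2 + Real.log N) := by
    rw [div_div, one_div, Real.log_inv, show 4 * N * 8 = 2 ^ 5 * N by ring,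
      Real.log_mul (by positivity) (by positivity), Real.log_pow]
    push_cast
    ring
  have hlog := Real.log_le_log (by positivity) hlow
  rw [Real.log_mul (by positivity) (by positivity), Real.log_mul (by positivity) (by positivity),
    Real.log_exp, Real.log_pow (_ * _), Real.log_pow (_ / 8), hη, hδ] at hlog
  push_cast at hlog
  rw [one_div, Real.log_inv]
  have ha : 0 ≤ Real.log (2 ^ n) := Real.log_nonneg hd1
  have hb : 0 ≤ Real.log N := Real.log_nonneg hN
  have hl2 := Real.log_two_lt_d9
  have hl2' : 0 < Real.log 2 := Real.log_pos (by norm_num)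
  have hk : (1 : ℝ) ≤ ρ.rank := by exact_mod_cast hρ.rank_pos
  set d : ℝ := 2 ^ n
  set a := Real.log d
  set b := Real.log N
  set k : ℝ := (ρ.rank : ℝ)
  set t := Real.log 2
  -- The weight terms carry no rank, and k ≥ 1 inserts one. The constant 12 is 5 + 7, from 3 log 2 +
  -- 2 ≤ 5 and 10 log 2 ≤ 7.
  have h1 : D₂ * d * a ≤ d * k * (D₂ * a) := by
    calc D₂ * d * a = d * 1 * (D₂ * a) := by ring
      _ ≤ _ := by gcongr
  have h2 : d * (2 * t + a + b + 2 + t) ≤ d * k * (a + b + 5) := by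
    calc d * (2 * t + a + b + 2 + t) ≤ d * (a + b + 5) :=
          mul_le_mul_of_nonneg_left (by linarith) hd.le
      _ = d * 1 * (a + b + 5) := by ring
      _ ≤ _ := by gcongr
  have h3 : 2 * d * k * (5 * t + b) ≤ d * k * (7 + 2 * b) := by
    calc 2 * d * k * (5 * t + b) = d * k * (10 * t + 2 * b) := by ring
      _ ≤ _ := by gcongr; linarith
  linear_combination hlog + h1 + h2 + h3

/-- For `N = m 3 ^ n`, the logarithms of `2 ^ n` and `N` are controlled by `log (k N / 2 ^ n)`. -/
theorem mul_log_le {n m : ℕ} (hm : 0 < m) {D k L : ℝ} (hD : 0 ≤ D) (hk : 1 ≤ k)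
    (hk' : k ≤ 2 ^ n) (hL : 2 / 3 ≤ L) :
    0 ≤ Real.log (k * (m * 3 ^ n) / 2 ^ n) ∧
    2 ^ n * k * ((D + 1) * Real.log (2 ^ n) + 3 * Real.log (m * 3 ^ n) + 12) ≤
      (2 * D + 47) * (2 ^ n * k * Real.log (k * (m * 3 ^ n) / 2 ^ n) + L) := by
  have hm1 : (1 : ℝ) ≤ m := by exact_mod_cast hm
  have hk0 : 0 < k := by linarith
  have hlm : 0 ≤ Real.log m := Real.log_nonneg hm1
  have hlk : 0 ≤ Real.log k := Real.log_nonneg hk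
  have hl : Real.log (k * (m * 3 ^ n) / 2 ^ n) =
      Real.log k + Real.log m + n * Real.log (3 / 2) := by
    rw [mul_div_assoc, mul_div_assoc, ← div_pow, Real.log_mul (by positivity) (by positivity),
      Real.log_mul (by positivity) (by positivity), Real.log_pow]
    ring
  have hlN : Real.log (m * 3 ^ n) = Real.log m + n * Real.log 3 := by
    rw [Real.log_mul (by positivity) (by positivity), Real.log_pow]
  have h32 : 0 < Real.log (3 / 2) := Real.log_pos (by norm_num)
  have hl0 : 0 ≤ Real.log (k * (m * 3 ^ n) / 2 ^ n) := by rw [hl]; positivity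
  refine ⟨hl0, ?_⟩
  -- For n = 0 and m = 1 the target logarithm vanishes, so the additive constant must be absorbed by
  -- `L`; for n ≥ 1 it is at least log(3/2).
  rcases Nat.eq_zero_or_pos n with rfl | hn
  · have hk1 : k = 1 := le_antisymm (by simpa using hk') hk
    subst hk1
    simp only [pow_zero, mul_one, one_mul, div_one, Real.log_one, mul_zero, zero_add]
    nlinarith [mul_nonneg hD hlm, mul_nonneg hD (by linarith : 0 ≤ L)]
  · have hn1 : (1 : ℝ) ≤ n := by exact_mod_cast hn
    -- These express 2 ≤ (3/2)², 3 ≤ (3/2)³ and e ≤ 3. The constant is then 2(D + 1) + 3·3 + 12·3 =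
    -- 2D + 47.
    have e1 : Real.log 2 ≤ 2 * Real.log (3 / 2) := by
      rw [← Real.log_rpow (by norm_num)]
      exact Real.log_le_log (by norm_num) (by norm_num)
    have e2 : Real.log 3 ≤ 3 * Real.log (3 / 2) := by
      rw [← Real.log_rpow (by norm_num)]
      exact Real.log_le_log (by norm_num) (by norm_num)
    have e3 : 1 ≤ 3 * Real.log (3 / 2) := by
      refine le_trans ?_ e2
      rw [Real.le_log_iff_exp_le (by norm_num)]
      linarith [Real.exp_one_lt_d9]
    set ℓ := Real.log (k * (m * 3 ^ n) / 2 ^ n)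
    have f1 : Real.log (2 ^ n) ≤ 2 * ℓ := by
      rw [Real.log_pow, hl]
      nlinarith
    have f2 : Real.log (m * 3 ^ n) ≤ 3 * ℓ := by
      rw [hlN, hl]
      nlinarith
    have f3 : 1 ≤ 3 * ℓ := by
      rw [hl]
      nlinarith
    calc 2 ^ n * k * ((D + 1) * Real.log (2 ^ n) + 3 * Real.log (m * 3 ^ n) + 12)
        ≤ 2 ^ n * k * ((D + 1) * (2 * ℓ) + 3 * (3 * ℓ) + 12 * (3 * ℓ)) := by
          gcongr
          linarith
      _ = (2 * D + 47) * (2 ^ n * k * ℓ + 0) := by ring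
      _ ≤ _ := by gcongr; linarith

end QuantumTomography

/-! ### The main theorem -/

theorem theorem2 (D₁ D₂ : ℝ) (hD₁ : 0 < D₁) (hD₂ : 0 < D₂) :
    ∃ C : ℝ, 0 < C ∧
      ∀ (n m : ℕ), 0 < m →
      ∀ (N : ℝ), N = (m : ℝ) * 3 ^ n →
      ∀ (ρ₀ : QuantumTomography.QMatrix n), QuantumTomography.IsDensityMatrix ρ₀ →
      ∀ (α : Fin (2 ^ n) → ℝ), QuantumTomography.PriorAssumption D₁ D₂ n α →
      ∀ {Ω : Type*} [MeasurableSpace Ω] (μ : Measure Ω) [IsProbabilityMeasure μ]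
        (R : Fin m → QuantumTomography.Setting n → Ω → QuantumTomography.Outcome n),
        QuantumTomography.IsCompleteData μ ρ₀ R →
      ∀ (ε : ℝ), 0 < ε → ε < 1 →
        1 - ε ≤ μ.real {ω |
          ‖QuantumTomography.densEstimator α (N / (4 * 5 ^ n)) (fun i a => R i a ω) - ρ₀‖ ^ 2 ≤
            C * ((10 ^ n * (ρ₀.rank : ℝ) * Real.log ((ρ₀.rank : ℝ) * N / 2 ^ n)
              + 5 ^ n * Real.log (2 / ε)) / N)} := by
  open QuantumTomography in
  -- Since 4/λ = 16 · 5^n / N, the prior mass contributes 16(2D₂ + 47). The 31 is 16 from log(1/ε)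
  -- plus 15 from the squared radius.
  refine ⟨31 + 16 * (2 * D₂ + 47), by positivity, ?_⟩
  intro n m hm N hN ρ₀ hρ α hα Ω _ μ _ R hR ε hε hε1
  have hm1 : (1 : ℝ) ≤ m := by exact_mod_cast hm
  have hN1 : 1 ≤ N := by
    rw [hN]
    exact one_le_mul_of_one_le_of_one_le hm1 (one_le_pow₀ (by norm_num))
  have hN0 : 0 < N := by linarith
  have := isProbabilityMeasure_prior hα.pos
  have hlam : 0 < N / (4 * 5 ^ n) := by positivity
  obtain ⟨hB, hlogB⟩ := neg_log_prior_closedBall_le hD₂ hα hρ hN1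
  have hpb := pac_bayes hm hR (lam := N / (4 * 5 ^ n)) (by rw [hN]) (prior n α) hB hε
  refine hpb.trans (measureReal_mono fun ω hω => ?_)
  simp only [Set.mem_ofPred_eq] at hω ⊢
  rw [densEstimator_eq_integral hα.pos hlam]
  refine hω.trans ?_
  have hL1 : Real.log (1 / ε) ≤ Real.log (2 / ε) := by
    apply Real.log_le_log (by positivity)
    gcongr
    norm_num
  have hL : 2 / 3 ≤ Real.log (2 / ε) := by
    have h2 : Real.log 2 ≤ Real.log (2 / ε) :=
      Real.log_le_log (by norm_num) ((le_div_iff₀ hε).2 (by linarith))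
    linarith [Real.log_two_gt_d9]
  have hk : (1 : ℝ) ≤ ρ₀.rank := by exact_mod_cast hρ.rank_pos
  have hk' : (ρ₀.rank : ℝ) ≤ 2 ^ n := by
    have h := ρ₀.rank_le_card_width
    simp only [Fintype.card_pi, Fintype.card_fin, Finset.prod_const, Finset.card_univ] at h
    exact_mod_cast h
  obtain ⟨hl0, hmain⟩ := mul_log_le hm hD₂.le hk hk' hL
  rw [← hN] at hl0 hmain
  have hlog := hlogB.trans hmain
  set P := Real.log (1 / (prior n α).real (Metric.closedBall ρ₀ (1 / N)))
  set ℓ := Real.log (ρ₀.rank * N / 2 ^ n)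
  set L := Real.log (2 / ε)
  have h5 : (1 : ℝ) ≤ 5 ^ n := one_le_pow₀ (by norm_num)
  have h10 : (10 : ℝ) ^ n = 5 ^ n * 2 ^ n := by rw [← mul_pow]; norm_num
  -- The radius term is absorbed by the confidence term, because L ≥ 2/3 and N ≥ 1.
  have hfirst : 10 * (1 / N) ^ 2 ≤ 15 * 5 ^ n * L / N := by
    rw [div_pow, one_pow, mul_one_div, div_le_div_iff₀ (by positivity) hN0]
    have h1 : 10 ≤ 15 * 5 ^ n * L := by nlinarith
    nlinarith [mul_nonneg hN0.le (by linarith : (0 : ℝ) ≤ N - 1)]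
  calc 10 * (1 / N) ^ 2 + 4 / (N / (4 * 5 ^ n)) * (Real.log (1 / ε) + P)
      ≤ 15 * 5 ^ n * L / N + 4 / (N / (4 * 5 ^ n)) *
          (L + (2 * D₂ + 47) * (2 ^ n * ρ₀.rank * ℓ + L)) := by gcongr
    _ = (5 ^ n * ((31 + 16 * (2 * D₂ + 47)) * L +
          16 * (2 * D₂ + 47) * (2 ^ n * ρ₀.rank * ℓ))) / N := by
        field_simp
        ring
    _ ≤ (5 ^ n * ((31 + 16 * (2 * D₂ + 47)) * L +
          (31 + 16 * (2 * D₂ + 47)) * (2 ^ n * ρ₀.rank * ℓ))) / N := by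
        gcongr
        linarith
    _ = _ := by rw [h10]; ring
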